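/- **Setting.** Fix a set $\mathit{dom}$ of non-fresh constants and a set $\Gamma_f$ of fresh constants, enumerated as a sequence; fresh constants come after all non-fresh ones. *Conceptual dependencies.* An EER schema $\mathcal C$ consists of finitely many entities, relationships (each among $n\ge 2$ entities $E_1,\dots,E_n$) and attributes (each of one entity or relationship), together with is-a links between entities, is-a links $R\to R'[j_1,\dots,j_n]$ between relationships of the same arity ($j$ a permutation), a choice of which attributes are mandatory and which are functional, and a choice of mandatory and functional participations of entities as $c$-th components of relationships in which they are the $c$-th entity. Its relational schema $\mathcal R$ has a unary predicate $e$ for each entity, an $n$-ary predicate $r$ for each $n$-ary relationship, and an $(n+1)$-ary predicate $a$ for each attribute of a concept with an $n$-ary predicate. The set $\Sigma$ of conceptual dependencies (CDs) of $\mathcal C$ consists of the inclusion dependencies (IDs) $a[1..n]\subseteq p[1..n]$ for each attribute $a$ of $p$; $p[1..n]\subseteq a[1..n]$ if $a$ is mandatory; $r[i]\subseteq e_i[1]$ for the $i$-th entity of $r$; $e[1]\subseteq e'[1]$ for each is-a between entities; $r[1..n]\subseteq r'[j_1,\dots,j_n]$ for each is-a between relationships; $e[1]\subseteq r[c]$ for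 each mandatory participation; and the key dependencies (KDs) $key(a)=\{1,\dots,n\}$ for each functional attribute and $key(r)=\{c\}$ for each functional participation. *Chase.* Let $D$ be a finite database over $\mathcal R$ with constants in $\mathit{dom}$. Fix total orders on facts and on dependencies, used only to break ties. The chase starts from $D$, all facts at level $0$, and repeats the following. (1) If two distinct facts of one relation agree on a key of it, take such a pair with the smallest minimum of the two levels (ties: first pair, then first KD) and identify their arguments position by position: two distinct non-fresh constants make the chase fail; otherwise the later of the two constants is replaced everywhere by the earlier one, non-fresh constants being earlier than fresh ones. Facts that become equal are collapsed and receive the minimum of their levels. (2) Otherwise, if some fact $r(t)$ violates an ID $r[X]\subseteq s[Y]$, take such a fact and ID, preferring full-width IDs (those in which all attributes of $r$ and of $s$ occur), then the lowest level of the fact, then the first fact, then the first ID; add a fact $s(t')$ with $t'[Y]=t[X]$ and new distinct fresh constants, later than all those used before, at the other positions. Its level is that of $r(t)$ plus $1$. The chase $chase(\Sigma,D)$ exists if this never fails; it is then the (possibly infinite) set of facts that are present from some step on, each with the level that it has from some step on. *Queries.* A conjunctive query $q$ over $\mathcal R$ has a head that is a finite sequence of distinct variables and a body that is a finite set of atoms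 with variables and constants of $\mathit{dom}$ as arguments; every head variable occurs in the body. A homomorphism maps variables to constants and fixes $\mathit{dom}$. An answer to $q$ over a set $B$ of facts is a tuple $t$ for which some homomorphism sends the body of $q$ to facts of $B$ and the head to $t$; it is fresh-free if all its entries are in $\mathit{dom}$. The join graph of $D$ has the atoms of $D$ as nodes, two distinct atoms being adjacent iff they share a constant; $\gamma(D)$ denotes the number of atoms of its largest connected component ($0$ if $D=\emptyset$). **Theorem.** Let $\Sigma$ be the set of CDs of an EER schema with relational schema $\mathcal R$, and let $q$ be a conjunctive query over $\mathcal R$. There is a function $\delta_M:\mathbb N\to\mathbb N$, depending only on $\mathcal R$, $\Sigma$ and $q$, such that for every finite database $D$ over $\mathcal R$ with constants in $\mathit{dom}$ for which $chase(\Sigma,D)$ exists (whatever the tie-breaking orders), and for every fresh-free answer $t$ to $q$ over $chase(\Sigma,D)$, there is a homomorphism $\mu$ that sends the head of $q$ to $t$ and the body of $q$ to facts of $chase(\Sigma,D)$, all of which have level at most $\delta_M(\gamma(D))$. -/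

import Mathlib

/-! ### Relational schemata, constants, atoms -/

/-- A relational schema: predicate symbols with arities. -/
structure RelSchema where
  Pred : Type*
  arity : Pred → ℕ

/-- Constants: non-fresh ones (from `Dom`) and fresh ones. The order in which fresh constants
follow one another is the order of `ℕ`; every fresh constant follows every non-fresh one. -/
inductive Const (Dom : Type*) where
  | dom (c : Dom)
  | fresh (k : ℕ)

/-- Atoms over a schema `R` with arguments in `α`; attributes are numbered from `0`. -/
@[ext]
structure Atom (R : RelSchema) (α : Type*) where
  pred : R.Pred
  args : Fin (R.arity pred) → α

/-- Apply a map to all the arguments of an atom. -/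
def Atom.map {R : RelSchema} {α β : Type*} (f : α → β) (A : Atom R α) : Atom R β :=
  ⟨A.pred, fun i => f (A.args i)⟩

/-- Facts: atoms whose arguments are (fresh or non-fresh) constants. -/
abbrev DBFact (R : RelSchema) (Dom : Type*) := Atom R (Const Dom)

/-! ### Dependencies -/

/-- An inclusion dependency `src[X] ⊆ tgt[Y]`, where `X` and `Y` are sequences of `width`
distinct attributes. -/
structure InclDep (R : RelSchema) where
  src : R.Pred
  tgt : R.Pred
  width : ℕ
  X : Fin width ↪ Fin (R.arity src)
  Y : Fin width ↪ Fin (R.arity tgt)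

/-- Every attribute of either predicate occurs (exactly once). -/
def InclDep.FullWidth {R : RelSchema} (σ : InclDep R) : Prop :=
  Function.Surjective σ.X ∧ Function.Surjective σ.Y

/-- A key dependency `key(pred) = key`. -/
structure KeyDep (R : RelSchema) where
  pred : R.Pred
  key : Finset (Fin (R.arity pred))
  two_le_arity : 2 ≤ R.arity pred
  key_nonempty : key.Nonempty

/-- A set of inclusion and key dependencies. -/
structure Deps (R : RelSchema) where
  ids : Set (InclDep R)
  kds : Set (KeyDep R)

/-! ### Extended entity-relationship schemata and conceptual dependencies -/

/-- An EER schema: finitely many entity, relationship and attribute symbols with their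
definitions. -/
structure EERSchema.{u} where
  Ent : Type u
  Rel : Type u
  Att : Type u
  finite_ent : Finite Ent
  finite_rel : Finite Rel
  finite_att : Finite Att
  /-- `entIsa E E'`: the definition of `E` lists `E'` in its is-a clause. -/
  entIsa : Ent → Ent → Prop
  /-- Arity of a relationship. -/
  relArity : Rel → ℕ
  two_le_relArity : ∀ R, 2 ≤ relArity R
  /-- The entities among which a relationship is defined. -/
  among : (R : Rel) → Fin (relArity R) → Ent
  /-- `relIsa R R' j`: the definition of `R` lists `R'[j₁,…,jₙ]` in its is-a clause. -/
  relIsa : (R R' : Rel) → (Fin (relArity R) ≃ Fin (relArity R')) → Prop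
  /-- Participation with minimum cardinality 1 of an entity as a component of a relationship. -/
  mandatoryPart : Ent → (R : Rel) → Fin (relArity R) → Prop
  /-- Participation with maximum cardinality 1 of an entity as a component of a relationship. -/
  functionalPart : Ent → (R : Rel) → Fin (relArity R) → Prop
  mandatoryPart_among : ∀ E R c, mandatoryPart E R c → among R c = E
  functionalPart_among : ∀ E R c, functionalPart E R c → among R c = E
  /-- The entity or relationship an attribute belongs to. -/
  owner : Att → Ent ⊕ Rel
  /-- The attributes qualified as functional. -/
  functionalAtt : Att → Prop
  /-- The attributes qualified as mandatory. -/
  mandatoryAtt : Att → Prop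

namespace EERSchema

/-- Predicates of the associated relational schema: one for each entity or relationship, and one
for each attribute. -/
inductive PredSym (C : EERSchema) where
  | concept (X : C.Ent ⊕ C.Rel)
  | att (A : C.Att)

/-- Entities have arity `1`, relationships their own arity. -/
def conceptArity (C : EERSchema) : C.Ent ⊕ C.Rel → ℕ
  | .inl _ => 1
  | .inr R => C.relArity R

/-- An attribute of a concept of arity `n` has arity `n + 1`. -/
def predArity (C : EERSchema) : C.PredSym → ℕ
  | .concept X => C.conceptArity X
  | .att A => C.conceptArity (C.owner A) + 1

/-- The relational schema associated with an EER schema. -/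
def relSchema (C : EERSchema) : RelSchema := ⟨C.PredSym, C.predArity⟩

def ent (C : EERSchema) (E : C.Ent) : C.relSchema.Pred := PredSym.concept (.inl E)

def rel (C : EERSchema) (R : C.Rel) : C.relSchema.Pred := PredSym.concept (.inr R)

def att (C : EERSchema) (A : C.Att) : C.relSchema.Pred := PredSym.att A

/-- The predicate of the concept that owns an attribute. -/
def ownerPred (C : EERSchema) (A : C.Att) : C.relSchema.Pred := PredSym.concept (C.owner A)

theorem conceptArity_pos (C : EERSchema) (X : C.Ent ⊕ C.Rel) : 0 < C.conceptArity X := by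
  cases X with
  | inl E => exact Nat.one_pos
  | inr R => exact lt_of_lt_of_le Nat.two_pos (C.two_le_relArity R)

/-- The sequence consisting of the single attribute `i`. -/
def single {n : ℕ} (i : Fin n) : Fin 1 ↪ Fin n := ⟨fun _ => i, fun _ _ _ => Subsingleton.elim _ _⟩

/-- `e[1]`, for a unary predicate `e`. -/
def entAttr (C : EERSchema) (E : C.Ent) : Fin 1 ↪ Fin (C.relSchema.arity (C.ent E)) :=
  Function.Embedding.refl (Fin 1)

/-- `r[i]`, for a relationship predicate `r`. -/
def relAttr (C : EERSchema) (R : C.Rel) (i : Fin (C.relArity R)) :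
    Fin 1 ↪ Fin (C.relSchema.arity (C.rel R)) := single (n := C.relArity R) i

/-- `a[1,…,n]`, for an attribute predicate `a` of arity `n + 1`. -/
def attAttrs (C : EERSchema) (A : C.Att) :
    Fin (C.conceptArity (C.owner A)) ↪ Fin (C.relSchema.arity (C.att A)) := Fin.castSuccEmb

/-- `p[1,…,n]`, for the predicate `p` of arity `n` that owns the attribute `A`. -/
def ownerAttrs (C : EERSchema) (A : C.Att) :
    Fin (C.conceptArity (C.owner A)) ↪ Fin (C.relSchema.arity (C.ownerPred A)) :=
  Function.Embedding.refl (Fin (C.conceptArity (C.owner A)))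

/-- The inclusion dependencies imposed by an EER schema. -/
inductive IsID (C : EERSchema) : InclDep C.relSchema → Prop
  /-- `a[1,…,n] ⊆ p[1,…,n]` for an attribute `a` of the entity or relationship `p`. -/
  | attOwner (A : C.Att) :
      IsID C ⟨C.att A, C.ownerPred A, _, C.attAttrs A, C.ownerAttrs A⟩
  /-- `r[i] ⊆ eᵢ[1]` for a relationship among `e₁,…,eₙ`. -/
  | component (R : C.Rel) (i : Fin (C.relArity R)) :
      IsID C ⟨C.rel R, C.ent (C.among R i), 1, C.relAttr R i, C.entAttr (C.among R i)⟩
  /-- `p[1,…,n] ⊆ a[1,…,n]` for a mandatory attribute `a` of `p`. -/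
  | attMandatory (A : C.Att) (h : C.mandatoryAtt A) :
      IsID C ⟨C.ownerPred A, C.att A, _, C.ownerAttrs A, C.attAttrs A⟩
  /-- `e[1] ⊆ e'[1]` for an is-a between entities. -/
  | entIsa (E E' : C.Ent) (h : C.entIsa E E') :
      IsID C ⟨C.ent E, C.ent E', 1, C.entAttr E, C.entAttr E'⟩
  /-- `r[1,…,n] ⊆ r'[j₁,…,jₙ]` for an is-a between relationships. -/
  | relIsa (R R' : C.Rel) (j : Fin (C.relArity R) ≃ Fin (C.relArity R')) (h : C.relIsa R R' j) :
      IsID C ⟨C.rel R, C.rel R', C.relArity R,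
        Function.Embedding.refl (Fin (C.relArity R)), j.toEmbedding⟩
  /-- `e[1] ⊆ r[c]` for a mandatory participation. -/
  | partMandatory (E : C.Ent) (R : C.Rel) (c : Fin (C.relArity R)) (h : C.mandatoryPart E R c) :
      IsID C ⟨C.ent E, C.rel R, 1, C.entAttr E, C.relAttr R c⟩

/-- `key(a) = {1,…,n}`, for an attribute predicate of arity `n + 1`. -/
def attKey (C : EERSchema) (A : C.Att) : KeyDep C.relSchema where
  pred := C.att A
  key := Finset.univ.map (C.attAttrs A)
  two_le_arity := Nat.succ_le_succ (C.conceptArity_pos (C.owner A))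
  key_nonempty := (Finset.univ_nonempty_iff.2 ⟨⟨0, C.conceptArity_pos (C.owner A)⟩⟩).map

/-- `key(r) = {c}`, for a relationship predicate. -/
def relKey (C : EERSchema) (R : C.Rel) (c : Fin (C.relArity R)) : KeyDep C.relSchema where
  pred := C.rel R
  key := ({c} : Finset (Fin (C.relArity R)))
  two_le_arity := C.two_le_relArity R
  key_nonempty := Finset.singleton_nonempty c

/-- The key dependencies imposed by an EER schema. -/
inductive IsKD (C : EERSchema) : KeyDep C.relSchema → Prop
  /-- Functional attributes. -/
  | attFunctional (A : C.Att) (h : C.functionalAtt A) : IsKD C (C.attKey A)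
  /-- Participations with maximum cardinality 1. -/
  | partFunctional (E : C.Ent) (R : C.Rel) (c : Fin (C.relArity R))
      (h : C.functionalPart E R c) : IsKD C (C.relKey R c)

/-- The conceptual dependencies of an EER schema. -/
def cds (C : EERSchema) : Deps C.relSchema := ⟨{σ | C.IsID σ}, {κ | C.IsKD κ}⟩

end EERSchema

/-! ### The chase -/

/-- A stage of the chase construction: the current facts, their levels, and the first fresh
constant that has not been used so far. -/
structure ChaseState (R : RelSchema) (Dom : Type*) where
  facts : Set (DBFact R Dom)
  level : DBFact R Dom → ℕ
  next : ℕ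

namespace Chase

open scoped Classical

variable {R : RelSchema} {Dom : Type*}

/-- The initial stage: the facts of the database, all at level `0`. -/
def init (D : Finset (Atom R Dom)) : ChaseState R Dom where
  facts := Atom.map Const.dom '' (D : Set (Atom R Dom))
  level := fun _ => 0
  next := 0

/-- The combined symbol of two constants; `none` for two distinct non-fresh constants. -/
noncomputable def combine : Const Dom → Const Dom → Option (Const Dom)
  | .dom c, .dom d => if c = d then some (.dom c) else none
  | .dom c, .fresh _ => some (.dom c)
  | .fresh _, .dom d => some (.dom d)
  | .fresh k, .fresh l => some (.fresh (min k l))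

/-- Extend the replacement `θ` made so far by merging (the current values of) `a` and `b`. -/
noncomputable def merge (θ : Const Dom → Const Dom) (a b : Const Dom) :
    Option (Const Dom → Const Dom) :=
  (combine (θ a) (θ b)).map fun c x => if θ x = θ a ∨ θ x = θ b then c else θ x

/-- Two tuples of the relation of a key dependency. -/
structure KDTrigger (R : RelSchema) (Dom : Type*) where
  kd : KeyDep R
  fst : Fin (R.arity kd.pred) → Const Dom
  snd : Fin (R.arity kd.pred) → Const Dom

namespace KDTrigger

def fstFact (τ : KDTrigger R Dom) : DBFact R Dom := ⟨τ.kd.pred, τ.fst⟩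

def sndFact (τ : KDTrigger R Dom) : DBFact R Dom := ⟨τ.kd.pred, τ.snd⟩

/-- The two tuples are distinct tuples of the current stage that agree on the key. -/
def Applicable (S : Deps R) (I : ChaseState R Dom) (τ : KDTrigger R Dom) : Prop :=
  τ.kd ∈ S.kds ∧ τ.fstFact ∈ I.facts ∧ τ.sndFact ∈ I.facts ∧ τ.fst ≠ τ.snd ∧
    ∀ i ∈ τ.kd.key, τ.fst i = τ.snd i

/-- The replacement of symbols that makes the two tuples equal, obtained by merging the symbols
at the non-key attributes one after the other; `none` if two distinct non-fresh constants would
have to be merged. -/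
noncomputable def unifier (τ : KDTrigger R Dom) : Option (Const Dom → Const Dom) :=
  ((List.finRange (R.arity τ.kd.pred)).filter (· ∉ τ.kd.key)).foldlM
    (fun θ i => merge θ (τ.fst i) (τ.snd i)) id

/-- The key dependency chase rule; `none` if it fails. Facts that become equal collapse to one
fact, whose level is the minimum of theirs. -/
noncomputable def apply (τ : KDTrigger R Dom) (I : ChaseState R Dom) :
    Option (ChaseState R Dom) :=
  τ.unifier.map fun θ =>
    { facts := Atom.map θ '' I.facts
      level := fun f => sInf {l | ∃ g ∈ I.facts, g.map θ = f ∧ I.level g = l}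
      next := I.next }

variable [LinearOrder (DBFact R Dom)] [LinearOrder (KeyDep R)]

/-- Priority of a trigger: first by the minimum of the two levels, then by the order of the pairs
of facts, then by the order of the key dependencies. -/
def rank (I : ChaseState R Dom) (τ : KDTrigger R Dom) :
    ℕ ×ₗ DBFact R Dom ×ₗ DBFact R Dom ×ₗ KeyDep R :=
  toLex (min (I.level τ.fstFact) (I.level τ.sndFact),
    toLex (τ.fstFact, toLex (τ.sndFact, τ.kd)))

/-- The applicable trigger that comes first. -/
def IsFirst (S : Deps R) (I : ChaseState R Dom) (τ : KDTrigger R Dom) : Prop :=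
  τ.Applicable S I ∧ ∀ τ' : KDTrigger R Dom, τ'.Applicable S I → τ.rank I ≤ τ'.rank I

end KDTrigger

/-- An inclusion dependency and a tuple of its left-hand relation. -/
structure IDTrigger (R : RelSchema) (Dom : Type*) where
  dep : InclDep R
  tup : Fin (R.arity dep.src) → Const Dom

namespace IDTrigger

def fact (τ : IDTrigger R Dom) : DBFact R Dom := ⟨τ.dep.src, τ.tup⟩

/-- The tuple is in the current stage and violates the inclusion dependency. -/
def Applicable (S : Deps R) (I : ChaseState R Dom) (τ : IDTrigger R Dom) : Prop :=
  τ.dep ∈ S.ids ∧ τ.fact ∈ I.facts ∧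
    ¬ ∃ t' : Fin (R.arity τ.dep.tgt) → Const Dom,
      (⟨τ.dep.tgt, t'⟩ : DBFact R Dom) ∈ I.facts ∧ ∀ i, t' (τ.dep.Y i) = τ.tup (τ.dep.X i)

/-- The new fact: it agrees with the given tuple as the dependency demands, and has pairwise
distinct fresh constants, following all those used so far, at the other attributes. -/
noncomputable def newFact (τ : IDTrigger R Dom) (I : ChaseState R Dom) : DBFact R Dom :=
  ⟨τ.dep.tgt, fun j =>
    if h : ∃ i, τ.dep.Y i = j then τ.tup (τ.dep.X h.choose) else .fresh (I.next + j)⟩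

/-- The inclusion dependency chase rule. -/
noncomputable def apply (τ : IDTrigger R Dom) (I : ChaseState R Dom) : ChaseState R Dom where
  facts := insert (τ.newFact I) I.facts
  level := Function.update I.level (τ.newFact I) (I.level τ.fact + 1)
  next := I.next + R.arity τ.dep.tgt

variable [LinearOrder (DBFact R Dom)] [LinearOrder (InclDep R)]

/-- Priority of a trigger: full-width dependencies first, then by the level of the fact, then by
the order of the facts, then by the order of the inclusion dependencies. -/
noncomputable def rank (I : ChaseState R Dom) (τ : IDTrigger R Dom) :
    ℕ ×ₗ ℕ ×ₗ DBFact R Dom ×ₗ InclDep R :=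
  toLex (if τ.dep.FullWidth then 0 else 1, toLex (I.level τ.fact, toLex (τ.fact, τ.dep)))

/-- The applicable trigger that comes first. -/
def IsFirst (S : Deps R) (I : ChaseState R Dom) (τ : IDTrigger R Dom) : Prop :=
  τ.Applicable S I ∧ ∀ τ' : IDTrigger R Dom, τ'.Applicable S I → τ.rank I ≤ τ'.rank I

end IDTrigger

variable [LinearOrder (DBFact R Dom)] [LinearOrder (InclDep R)] [LinearOrder (KeyDep R)]

/-- One chase step: the key dependency rule if it is applicable, otherwise the inclusion
dependency rule if it is applicable, otherwise nothing; `none` stands for failure. -/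
noncomputable def step (S : Deps R) (I : ChaseState R Dom) : Option (ChaseState R Dom) :=
  if h : ∃ τ : KDTrigger R Dom, τ.IsFirst S I then h.choose.apply I
  else if h : ∃ τ : IDTrigger R Dom, τ.IsFirst S I then some (h.choose.apply I)
  else some I

/-- The stages of the chase of `D`; `none` from the moment of failure on. -/
noncomputable def stage (S : Deps R) (D : Finset (Atom R Dom)) : ℕ → Option (ChaseState R Dom)
  | 0 => some (init D)
  | n + 1 => (stage S D n).bind (step S)

/-- The chase exists if its construction never fails. -/
def Exists (S : Deps R) (D : Finset (Atom R Dom)) : Prop := ∀ n, (stage S D n).isSome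

/-- The (possibly infinite) chase: the facts that belong to all stages from some stage on. -/
def chase (S : Deps R) (D : Finset (Atom R Dom)) : Set (DBFact R Dom) :=
  {f | ∀ᶠ n in Filter.atTop, ∃ I, stage S D n = some I ∧ f ∈ I.facts}

/-- `f` is a fact of the chase, and its level (the one it has from some stage on) is `l`. -/
def HasLevel (S : Deps R) (D : Finset (Atom R Dom)) (f : DBFact R Dom) (l : ℕ) : Prop :=
  ∀ᶠ n in Filter.atTop, ∃ I, stage S D n = some I ∧ f ∈ I.facts ∧ I.level f = l

/-- The facts of the chase whose level is at most `m`. -/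
def firstLevels (S : Deps R) (D : Finset (Atom R Dom)) (m : ℕ) : Set (DBFact R Dom) :=
  {f | ∃ l ≤ m, HasLevel S D f l}

end Chase

/-! ### The join graph -/

/-- The join graph of a database: two distinct atoms are adjacent iff they share a constant. -/
def joinGraph {R : RelSchema} {Dom : Type*} (D : Finset (Atom R Dom)) :
    SimpleGraph {A : Atom R Dom // A ∈ D} where
  Adj A B := A ≠ B ∧ ∃ i j, A.1.args i = B.1.args j
  symm := ⟨fun _ _ h => ⟨h.1.symm, let ⟨i, j, e⟩ := h.2; ⟨j, i, e.symm⟩⟩⟩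
  loopless := ⟨fun _ h => h.1 rfl⟩

/-- The number of atoms of a largest connected component of the join graph (`0` if the database
is empty). -/
noncomputable def largestComponent {R : RelSchema} {Dom : Type*} (D : Finset (Atom R Dom)) : ℕ :=
  ⨆ K : (joinGraph D).ConnectedComponent, K.supp.ncard

/-! ### Conjunctive queries -/

/-- Terms of a query: variables and non-fresh constants. -/
inductive Term (Dom Var : Type*) where
  | const (c : Dom)
  | var (x : Var)

/-- The value of a term under a mapping of the variables; non-fresh constants are fixed. -/
def Term.value {Dom Var : Type*} (μ : Var → Const Dom) : Term Dom Var → Const Dom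
  | .const c => .dom c
  | .var x => μ x

/-- A conjunctive query: the head is a sequence of distinct variables, each of which occurs in
the body. -/
structure ConjQuery (R : RelSchema) (Dom Var : Type*) where
  arity : ℕ
  head : Fin arity → Var
  body : Finset (Atom R (Term Dom Var))
  head_injective : Function.Injective head
  rangeRestricted : ∀ i, ∃ A ∈ body, ∃ j, A.args j = .var (head i)

namespace ConjQuery

variable {R : RelSchema} {Dom Var : Type*}

/-- `μ` is a homomorphism that sends the body of `q` to facts in `B` and the head to `t`. -/
def IsWitness (q : ConjQuery R Dom Var) (B : Set (DBFact R Dom)) (t : Fin q.arity → Const Dom)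
    (μ : Var → Const Dom) : Prop :=
  (∀ A ∈ q.body, A.map (Term.value μ) ∈ B) ∧ ∀ i, μ (q.head i) = t i

/-- The answers to `q` over a database. -/
def answers (q : ConjQuery R Dom Var) (B : Set (DBFact R Dom)) : Set (Fin q.arity → Const Dom) :=
  {t | ∃ μ, q.IsWitness B t μ}

/-- The answers that contain no fresh constants. -/
def freshFreeAnswers (q : ConjQuery R Dom Var) (B : Set (DBFact R Dom)) :
    Set (Fin q.arity → Const Dom) :=
  {t | t ∈ q.answers B ∧ ∀ i, ∃ c, t i = .dom c}

end ConjQuery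

/-!
Color the constants of the database by the components of its join graph. Every inclusion dependency
propagates a constant, and the key dependency rule only identifies constants of the same color, so
the coloring extends to the fresh constants in such a way that all facts stay monochromatic. The
parts of the chase in different colors then do not influence one another, except through the order
of the steps.

Let `v` be the least level of a violation of an inclusion dependency in one color. Until all such
violations are repaired, additions that are not full-width happen only at levels at most `v`, so in
this color they repair one of the finitely many violations of level `v`. The other steps in this
color identify constants, or add facts without fresh constants. A potential that weighs the
violations, the constants and the absent facts therefore decreases, and it bounds what happens
before level `v` is done in terms of `v` and the number `g` of atoms of the color, whatever the
tie-breaking orders are. Hence in the limit the key dependencies hold, and violations have been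
repaired by facts of bounded level.

Consequently the facts of selected colors at stage `n` of one chase map homomorphically to facts of
another chase whose levels are bounded in terms of `n` and `g`, as soon as the atoms of these colors
in the first database map into the second one. A match of the query touches boundedly many
components, and up to renaming there are finitely many possibilities for the atoms of these
components, the answer and the constants of the query. For each possibility that occurs, fix a stage
at which some chase has such a match; transferring that match bounds the levels.
-/

/-! ### Atoms and their arguments -/

namespace RelSchema

/-- The largest arity of a predicate (meaningful only if the arities are bounded). -/
noncomputable def maxArity (R : RelSchema) : ℕ := ⨆ p, R.arity p

theorem arity_le_maxArity (R : RelSchema) [Finite R.Pred] (p : R.Pred) :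
    R.arity p ≤ R.maxArity :=
  le_ciSup (Set.finite_range R.arity).bddAbove p

end RelSchema

namespace Atom

variable {R : RelSchema} {α β γ κ : Type*}

theorem map_map (f : α → β) (g : β → γ) (A : Atom R α) : (A.map f).map g = A.map (g ∘ f) := rfl

theorem map_congr {f g : α → β} {A : Atom R α} (h : ∀ i, f (A.args i) = g (A.args i)) :
    A.map f = A.map g := by
  simp only [Atom.map, h]

theorem map_eq_self {f : α → α} {A : Atom R α} (h : ∀ i, f (A.args i) = A.args i) :
    A.map f = A :=
  map_congr (g := id) h

theorem exists_of_map_eq_mk {f : α → β} {A : Atom R α} {p : R.Pred} {t : Fin (R.arity p) → β}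
    (h : A.map f = ⟨p, t⟩) : ∃ s, A = ⟨p, s⟩ ∧ ∀ i, f (s i) = t i := by
  cases h
  exact ⟨A.args, rfl, fun _ => rfl⟩

theorem args_eq_of_map_eq_self {f : α → α} {A : Atom R α} (h : A.map f = A)
    (i : Fin (R.arity A.pred)) : f (A.args i) = A.args i := by
  obtain ⟨s, hs, hf⟩ := exists_of_map_eq_mk h
  obtain rfl : A.args = s := eq_of_heq (Atom.mk.inj hs).2
  exact hf i

theorem map_injective {f : α → β} (hf : Function.Injective f) :
    Function.Injective (Atom.map (R := R) f) := by
  intro A ⟨p, t⟩ h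
  obtain ⟨s, rfl, hs⟩ := exists_of_map_eq_mk h
  rw [funext fun i => hf (hs i)]

def equivSigma (R : RelSchema) (α : Type*) : Atom R α ≃ Σ p : R.Pred, (Fin (R.arity p) → α) where
  toFun A := ⟨A.pred, A.args⟩
  invFun A := ⟨A.1, A.2⟩

instance [Finite R.Pred] [Finite α] : Finite (Atom R α) :=
  Finite.of_equiv _ (equivSigma R α).symm

/-- The number of atoms with arguments in a set of `c` elements. -/
noncomputable def count (R : RelSchema) (c : ℕ) : ℕ := Nat.card (Atom R (Fin c))

theorem count_mono [Finite R.Pred] : Monotone (count R) := fun _ _ h =>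
  Nat.card_le_card_of_injective _ (map_injective (Fin.castLE_injective h))

/-- The atoms all of whose arguments lie in `X`. -/
def withArgsIn (R : RelSchema) (X : Set α) : Set (Atom R α) := {A | ∀ i, A.args i ∈ X}

theorem withArgsIn_eq_range (X : Set α) :
    withArgsIn R X = Set.range (Atom.map (R := R) (Subtype.val : X → α)) := by
  ext A
  constructor
  · exact fun h => ⟨⟨A.pred, fun i => ⟨A.args i, h i⟩⟩, rfl⟩
  · rintro ⟨B, rfl⟩ i
    exact (B.args i).2

theorem finite_withArgsIn [Finite R.Pred] {X : Set α} (hX : X.Finite) :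
    (withArgsIn R X).Finite := by
  have := hX.to_subtype
  exact withArgsIn_eq_range (R := R) X ▸ Set.finite_range _

theorem ncard_withArgsIn_le [Finite R.Pred] {X : Set α} (hX : X.Finite) :
    (withArgsIn R X).ncard ≤ count R X.ncard := by
  have := hX.to_subtype
  have e : X ≃ Fin X.ncard := Finite.equivFinOfCardEq rfl
  rw [withArgsIn_eq_range, ← Nat.card_coe_set_eq]
  exact (Nat.card_le_card_of_surjective _ Set.rangeFactorization_surjective).trans
    (Nat.card_le_card_of_injective _ (map_injective e.injective))

/-- The constants that occur in a set of atoms. -/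
def consts (B : Set (Atom R α)) : Set α := ⋃ A ∈ B, Set.range A.args

theorem mem_consts_of_mem {B : Set (Atom R α)} {A : Atom R α} (hA : A ∈ B)
    (i : Fin (R.arity A.pred)) : A.args i ∈ consts B :=
  Set.mem_biUnion hA ⟨i, rfl⟩

theorem subset_withArgsIn_consts (B : Set (Atom R α)) : B ⊆ withArgsIn R (consts B) :=
  fun _ hA => mem_consts_of_mem hA

theorem consts_subset_iff {B : Set (Atom R α)} {X : Set α} : consts B ⊆ X ↔ B ⊆ withArgsIn R X := by
  simp only [consts, Set.iUnion_subset_iff, Set.range_subset_iff]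
  rfl

theorem consts_mono : Monotone (consts : Set (Atom R α) → Set α) :=
  fun _ B h => consts_subset_iff.2 (h.trans (subset_withArgsIn_consts B))

theorem consts_image_map (f : α → β) (B : Set (Atom R α)) :
    consts (Atom.map f '' B) = f '' consts B := by
  simp only [consts, Set.biUnion_image, Set.image_iUnion, ← Set.range_comp]
  rfl

theorem finite_consts {B : Set (Atom R α)} (hB : B.Finite) : (consts B).Finite :=
  hB.biUnion fun _ _ => Set.finite_range _

theorem ncard_le_count_consts [Finite R.Pred] {B : Set (Atom R α)} (hB : B.Finite) :
    B.ncard ≤ count R (consts B).ncard :=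
  (Set.ncard_le_ncard (subset_withArgsIn_consts B) (finite_withArgsIn (finite_consts hB))).trans
    (ncard_withArgsIn_le (finite_consts hB))

theorem ncard_consts_le [Finite R.Pred] {B : Set (Atom R α)} (hB : B.Finite) :
    (consts B).ncard ≤ B.ncard * R.maxArity := by
  classical
  have hcoe : consts B = ↑(hB.toFinset.biUnion fun A => Finset.univ.image A.args) := by
    simp [consts]
  rw [hcoe, Set.ncard_coe_finset, Set.ncard_eq_toFinset_card B hB]
  refine Finset.card_biUnion_le_card_mul _ _ _ fun A _ => Finset.card_image_le.trans ?_
  simpa using R.arity_le_maxArity A.pred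

/-- The atoms that are not in `B` but could be formed from the constants of `B`. -/
def absent (B : Set (Atom R α)) : Set (Atom R α) := withArgsIn R (consts B) \ B

theorem finite_absent [Finite R.Pred] {B : Set (Atom R α)} (hB : B.Finite) : (absent B).Finite :=
  (finite_withArgsIn (finite_consts hB)).subset Set.sdiff_subset

theorem ncard_absent_le [Finite R.Pred] {B : Set (Atom R α)} (hB : B.Finite) :
    (absent B).ncard ≤ count R (consts B).ncard :=
  (Set.ncard_le_ncard Set.sdiff_subset (finite_withArgsIn (finite_consts hB))).trans
    (ncard_withArgsIn_le (finite_consts hB))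

theorem absent_ssubset_absent {B B' : Set (Atom R α)} (h : B ⊂ B') (hc : consts B' ⊆ consts B) :
    absent B' ⊂ absent B := by
  obtain ⟨A, hA, hAB⟩ := Set.exists_of_ssubset h
  rw [absent, (consts_mono h.subset).antisymm hc |>.symm]
  refine ⟨Set.sdiff_subset_sdiff_right h.subset, fun hle => ?_⟩
  exact (hle ⟨consts_subset_iff.1 hc hA, hAB⟩).2 hA

/-- The atoms of `B` whose arguments have colors in `K`, for a coloring `col` of the arguments. -/
def coloredIn (B : Set (Atom R α)) (col : α → κ) (K : Set κ) : Set (Atom R α) :=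
  {A ∈ B | ∀ i, col (A.args i) ∈ K}

theorem finite_coloredIn {B : Set (Atom R α)} (hB : B.Finite) (col : α → κ) (K : Set κ) :
    (coloredIn B col K).Finite :=
  hB.subset fun _ h => h.1

theorem coloredIn_image_map (f : α → β) (B : Set (Atom R α)) (col : β → κ) (K : Set κ) :
    coloredIn (Atom.map f '' B) col K = Atom.map f '' coloredIn B (col ∘ f) K := by
  ext A
  constructor
  · rintro ⟨⟨A, hA, rfl⟩, hK⟩
    exact ⟨A, ⟨hA, hK⟩, rfl⟩
  · rintro ⟨A, ⟨hA, hK⟩, rfl⟩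
    exact ⟨⟨A, hA, rfl⟩, hK⟩

/-- All arguments of each atom have the same color. -/
def Monochromatic (B : Set (Atom R α)) (col : α → κ) : Prop :=
  ∀ A ∈ B, ∀ i j, col (A.args i) = col (A.args j)

theorem Monochromatic.image_map {B : Set (Atom R α)} {f : α → β} {col : β → κ}
    (h : Monochromatic B (col ∘ f)) : Monochromatic (Atom.map f '' B) col := by
  rintro _ ⟨A, hA, rfl⟩
  exact h A hA

end Atom

/-! ### Finiteness of the sets of dependencies -/

namespace InclDep

variable {R : RelSchema}

theorem width_le_arity_src (σ : InclDep R) : σ.width ≤ R.arity σ.src := by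
  simpa using Fintype.card_le_of_embedding σ.X

instance [Finite R.Pred] : Finite (InclDep R) := by
  refine Finite.of_surjective
    (α := Σ (s t : R.Pred) (w : Fin (R.arity s + 1)),
      (Fin w ↪ Fin (R.arity s)) × (Fin w ↪ Fin (R.arity t)))
    (fun x => ⟨x.1, x.2.1, x.2.2.1, x.2.2.2.1, x.2.2.2.2⟩) fun σ => ?_
  exact ⟨⟨σ.src, σ.tgt, ⟨σ.width, Nat.lt_succ_of_le σ.width_le_arity_src⟩, σ.X, σ.Y⟩, rfl⟩

end InclDep

instance {R : RelSchema} [Finite R.Pred] : Finite (KeyDep R) := by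
  refine Finite.of_injective
    (fun κ : KeyDep R => (⟨κ.pred, κ.key⟩ : Σ p : R.Pred, Finset (Fin (R.arity p)))) ?_
  rintro ⟨p, k, _, _⟩ ⟨_, _, _, _⟩ h
  cases h
  rfl

/-! ### Unifiers -/

namespace Const

variable {Dom : Type*} {u v w : Const Dom}

/-- The position of a constant in the order of replacement, in which all non-fresh constants
share position `0`. Thus the fresh constants `x` used before `.fresh k` are those with
`rank x ≤ k`. -/
def rank : Const Dom → ℕ
  | .dom _ => 0
  | .fresh k => k + 1

/-- `u` may replace `v`: it is `v` or strictly earlier than `v` in the order of replacement. -/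
def Precedes (u v : Const Dom) : Prop := u = v ∨ u.rank < v.rank

theorem Precedes.rank_le (h : Precedes u v) : u.rank ≤ v.rank := by
  obtain rfl | h := h
  exacts [le_rfl, h.le]

theorem Precedes.trans (huv : Precedes u v) (hvw : Precedes v w) : Precedes u w := by
  obtain rfl | huv := huv
  exacts [hvw, .inr (huv.trans_le hvw.rank_le)]

theorem Precedes.eq_dom {d : Dom} (h : Precedes u (.dom d)) : u = .dom d :=
  h.resolve_right (Nat.not_lt_zero _)

end Const

namespace Chase

variable {R : RelSchema} {Dom : Type*}

theorem combine_spec {u v c : Const Dom} (h : combine u v = some c) :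
    (c = u ∨ c = v) ∧ c.Precedes u ∧ c.Precedes v := by
  cases u with
  | dom a =>
    cases v with
    | dom b =>
      simp only [combine, Option.ite_none_right_eq_some] at h
      obtain ⟨rfl, h⟩ := h
      cases h
      simp [Const.Precedes]
    | fresh l =>
      cases h
      simp [Const.Precedes, Const.rank]
  | fresh k =>
    cases v with
    | dom b =>
      cases h
      simp [Const.Precedes, Const.rank]
    | fresh l =>
      cases h
      simp only [Const.Precedes, Const.rank, Const.fresh.injEq]
      omega

/-- `θ` arises from the identity by merging constants and identifies the two components of each
pair in `P`; the constants it identifies are equivalent modulo `P`. -/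
structure IsUnifier (P : Set (Const Dom × Const Dom)) (θ : Const Dom → Const Dom) : Prop where
  unifies : ∀ p ∈ P, θ p.1 = θ p.2
  rel : ∀ s : Setoid (Const Dom), (∀ p ∈ P, s p.1 p.2) → ∀ x, s (θ x) x
  precedes : ∀ x, (θ x).Precedes x

theorem isUnifier_id : IsUnifier (∅ : Set (Const Dom × Const Dom)) id :=
  ⟨by simp, fun s _ x => s.refl x, fun _ => .inl rfl⟩

open scoped Classical in
theorem merge_eq_some {θ θ' : Const Dom → Const Dom} {a b : Const Dom}
    (h : merge θ a b = some θ') :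
    ∃ c, combine (θ a) (θ b) = some c ∧
      ∀ x, θ' x = if θ x = θ a ∨ θ x = θ b then c else θ x := by
  obtain ⟨c, hc, rfl⟩ := Option.map_eq_some_iff.1 h
  exact ⟨c, hc, fun _ => rfl⟩

namespace IsUnifier

variable {P : Set (Const Dom × Const Dom)} {θ θ' : Const Dom → Const Dom}

protected theorem merge (hθ : IsUnifier P θ) {a b : Const Dom} (h : merge θ a b = some θ') :
    IsUnifier (insert (a, b) P) θ' := by
  obtain ⟨c, hc, hθ'⟩ := merge_eq_some h
  obtain ⟨hmem, hca, hcb⟩ := combine_spec hc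
  refine ⟨?_, fun s hP x => ?_, fun x => ?_⟩
  · rintro p (rfl | hp)
    · simp only [hθ', true_or, or_true, if_true]
    · rw [hθ', hθ', hθ.unifies p hp]
  · have hx := hθ.rel s fun p hp => hP p (.inr hp)
    have hab : s a b := hP (a, b) (.inl rfl)
    have hca : s c a := by
      obtain rfl | rfl := hmem
      exacts [hx a, s.trans (hx b) (s.symm hab)]
    rw [hθ' x]
    split_ifs with hor
    · obtain e | e := hor
      · exact s.trans hca (s.trans (s.symm (hx a)) (e ▸ hx x))
      · exact s.trans (s.trans hca hab) (s.trans (s.symm (hx b)) (e ▸ hx x))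
    · exact hx x
  · rw [hθ' x]
    split_ifs with hor
    · have hcx : c.Precedes (θ x) := by
        obtain e | e := hor
        exacts [e ▸ hca, e ▸ hcb]
      exact hcx.trans (hθ.precedes x)
    · exact hθ.precedes x

protected theorem foldlM {ι : Type*} (f g : ι → Const Dom) (l : List ι) (hθ : IsUnifier P θ)
    (h : l.foldlM (fun θ i => Chase.merge θ (f i) (g i)) θ = some θ') :
    IsUnifier (P ∪ (fun i => (f i, g i)) '' {i | i ∈ l}) θ' := by
  induction l generalizing P θ with
  | nil =>
    cases h
    simpa using hθ
  | cons i l ih =>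
    rw [List.foldlM_cons] at h
    obtain ⟨θ₁, h₁, h₂⟩ := Option.bind_eq_some_iff.1 h
    have hcons : {j | j ∈ i :: l} = insert i {j | j ∈ l} := by
      ext
      simp
    rw [hcons, Set.image_insert_eq, Set.union_insert, ← Set.insert_union]
    exact ih (hθ.merge h₁) h₂

theorem apply_eq_of_unifies {κ : Type*} (hθ : IsUnifier P θ) {h : Const Dom → κ}
    (hP : ∀ p ∈ P, h p.1 = h p.2) (x : Const Dom) : h (θ x) = h x :=
  hθ.rel (Setoid.ker h) hP x

theorem apply_apply (hθ : IsUnifier P θ) (x : Const Dom) : θ (θ x) = θ x :=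
  hθ.apply_eq_of_unifies hθ.unifies x

theorem apply_eq_self (hθ : IsUnifier P θ) {x : Const Dom}
    (hx : ∀ p ∈ P, x ≠ p.1 ∧ x ≠ p.2) : θ x = x := by
  have hiff := hθ.apply_eq_of_unifies (h := (· = x)) (fun p hp => by
    simp only [(hx p hp).1.symm, (hx p hp).2.symm]) x
  simpa using hiff

end IsUnifier

namespace KDTrigger

/-- The pairs of constants that the key dependency rule identifies. -/
def pairs (τ : KDTrigger R Dom) : Set (Const Dom × Const Dom) :=
  Set.range fun i => (τ.fst i, τ.snd i)

theorem isUnifier {S : Deps R} {I : ChaseState R Dom} {τ : KDTrigger R Dom}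
    (hτ : τ.Applicable S I) {θ : Const Dom → Const Dom} (h : τ.unifier = some θ) :
    IsUnifier τ.pairs θ := by
  have hfold := isUnifier_id.foldlM τ.fst τ.snd _ h
  rw [Set.empty_union] at hfold
  obtain ⟨-, -, -, -, hkey⟩ := hτ
  refine ⟨?_, fun s hs => hfold.rel s ?_, hfold.precedes⟩
  · rintro _ ⟨i, rfl⟩
    by_cases hi : i ∈ τ.kd.key
    · simp only [hkey i hi]
    · exact hfold.unifies _ ⟨i, by simp [hi], rfl⟩
  · rintro _ ⟨i, -, rfl⟩
    exact hs _ ⟨i, rfl⟩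

end KDTrigger

end Chase

/-! ### Single steps -/

/-- Replace the constants of a stage. Facts that become equal collapse to one fact, whose level is
the minimum of theirs. -/
noncomputable def ChaseState.map {R : RelSchema} {Dom : Type*} (θ : Const Dom → Const Dom)
    (I : ChaseState R Dom) : ChaseState R Dom where
  facts := Atom.map θ '' I.facts
  level := fun f => sInf {l | ∃ g ∈ I.facts, g.map θ = f ∧ I.level g = l}
  next := I.next

theorem ChaseState.exists_preimage_of_mem_map {R : RelSchema} {Dom : Type*}
    {θ : Const Dom → Const Dom} {I : ChaseState R Dom} {f : DBFact R Dom}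
    (hf : f ∈ (I.map θ).facts) : ∃ g ∈ I.facts, g.map θ = f ∧ I.level g = (I.map θ).level f := by
  obtain ⟨g, hg, rfl⟩ := hf
  exact Nat.sInf_mem (s := {l | ∃ h ∈ I.facts, h.map θ = g.map θ ∧ I.level h = l})
    ⟨_, g, hg, rfl, rfl⟩

namespace Chase

variable {R : RelSchema} {Dom : Type*} {S : Deps R} {I J : ChaseState R Dom}
  {θ : Const Dom → Const Dom}

namespace KDTrigger

theorem apply_eq_some {τ : KDTrigger R Dom} (h : τ.apply I = some J) :
    ∃ θ, τ.unifier = some θ ∧ J = I.map θ := by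
  obtain ⟨θ, hθ, rfl⟩ := Option.map_eq_some_iff.1 h
  exact ⟨θ, hθ, rfl⟩

theorem finite_applicable [Finite R.Pred] (hI : I.facts.Finite) :
    {τ : KDTrigger R Dom | τ.Applicable S I}.Finite := by
  refine Set.Finite.of_injOn (f := fun τ : KDTrigger R Dom => (τ.kd, τ.fstFact, τ.sndFact))
    (t := Set.univ ×ˢ I.facts ×ˢ I.facts) (fun τ hτ => ⟨trivial, hτ.2.1, hτ.2.2.1⟩) ?_
    (Set.finite_univ.prod (hI.prod hI))
  rintro ⟨κ, s, t⟩ - ⟨κ', s', t'⟩ - h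
  cases h
  rfl

theorem exists_isFirst [Finite R.Pred] [LinearOrder (DBFact R Dom)] [LinearOrder (KeyDep R)]
    (hI : I.facts.Finite) {τ : KDTrigger R Dom} (hτ : τ.Applicable S I) :
    ∃ τ : KDTrigger R Dom, τ.IsFirst S I :=
  Set.exists_min_image _ (rank I) (finite_applicable hI) ⟨τ, hτ⟩

end KDTrigger

namespace IDTrigger

theorem newFact_args_Y (τ : IDTrigger R Dom) (I : ChaseState R Dom) (i : Fin τ.dep.width) :
    (τ.newFact I).args (τ.dep.Y i) = τ.tup (τ.dep.X i) := by
  have h : ∃ i', τ.dep.Y i' = τ.dep.Y i := ⟨i, rfl⟩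
  simp only [newFact, dif_pos h]
  rw [τ.dep.Y.injective h.choose_spec]

theorem newFact_args_of_notMem (τ : IDTrigger R Dom) (I : ChaseState R Dom)
    {j : Fin (R.arity τ.dep.tgt)} (h : j ∉ Set.range τ.dep.Y) :
    (τ.newFact I).args j = .fresh (I.next + j) :=
  dif_neg h

theorem newFact_notMem {τ : IDTrigger R Dom} (h : τ.Applicable S I) : τ.newFact I ∉ I.facts :=
  fun hmem => h.2.2 ⟨(τ.newFact I).args, hmem, τ.newFact_args_Y I⟩

theorem level_apply_newFact (τ : IDTrigger R Dom) (I : ChaseState R Dom) :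
    (τ.apply I).level (τ.newFact I) = I.level τ.fact + 1 := by
  simp [apply]

theorem level_apply_of_mem {τ : IDTrigger R Dom} (h : τ.Applicable S I) {f : DBFact R Dom}
    (hf : f ∈ I.facts) : (τ.apply I).level f = I.level f := by
  simp [apply, ne_of_mem_of_not_mem hf (newFact_notMem h)]

theorem dep_fact_injective :
    Function.Injective fun τ : IDTrigger R Dom => (τ.dep, τ.fact) := by
  rintro ⟨σ, s⟩ ⟨σ', s'⟩ h
  cases h
  rfl

theorem finite_applicable [Finite R.Pred] (hI : I.facts.Finite) :
    {τ : IDTrigger R Dom | τ.Applicable S I}.Finite :=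
  Set.Finite.of_injOn (t := Set.univ ×ˢ I.facts) (fun _ hτ => ⟨trivial, hτ.2.1⟩)
    dep_fact_injective.injOn (Set.finite_univ.prod hI)

theorem exists_isFirst [Finite R.Pred] [LinearOrder (DBFact R Dom)] [LinearOrder (InclDep R)]
    (hI : I.facts.Finite) {τ : IDTrigger R Dom} (hτ : τ.Applicable S I) :
    ∃ τ : IDTrigger R Dom, τ.IsFirst S I :=
  Set.exists_min_image _ (rank I) (finite_applicable hI) ⟨τ, hτ⟩

theorem IsFirst.level_le [LinearOrder (DBFact R Dom)] [LinearOrder (InclDep R)]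
    {τ τ' : IDTrigger R Dom} (hτ : τ.IsFirst S I) (hτ' : τ'.Applicable S I)
    (hfull : ¬ τ.dep.FullWidth) : I.level τ.fact ≤ I.level τ'.fact := by
  have hle := hτ.2 τ' hτ'
  simp only [rank, if_neg hfull, Prod.Lex.toLex_le_toLex] at hle
  obtain hlt | ⟨-, hlt | ⟨heq, -⟩⟩ := hle
  · split_ifs at hlt <;> omega
  · exact hlt.le
  · exact heq.le

end IDTrigger

/-- `Next S I θ J`: a chase step leads from `I` to `J` and replaces constants according to `θ`.
Only that part of the order of rule applications is recorded that does not depend on how ties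
are broken. -/
inductive Next (S : Deps R) (I : ChaseState R Dom) :
    (Const Dom → Const Dom) → ChaseState R Dom → Prop
  | kd (τ : KDTrigger R Dom) (θ : Const Dom → Const Dom) (happ : τ.Applicable S I)
      (hθ : IsUnifier τ.pairs θ) : Next S I θ (I.map θ)
  | id (τ : IDTrigger R Dom) (hkd : ∀ τ' : KDTrigger R Dom, ¬ τ'.Applicable S I)
      (happ : τ.Applicable S I)
      (hmin : ¬ τ.dep.FullWidth → ∀ τ' : IDTrigger R Dom, τ'.Applicable S I →
        I.level τ.fact ≤ I.level τ'.fact) : Next S I id (τ.apply I)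
  | idle (hkd : ∀ τ' : KDTrigger R Dom, ¬ τ'.Applicable S I)
      (hid : ∀ τ' : IDTrigger R Dom, ¬ τ'.Applicable S I) : Next S I id I

theorem exists_next_of_step_eq_some [Finite R.Pred] [LinearOrder (DBFact R Dom)]
    [LinearOrder (InclDep R)] [LinearOrder (KeyDep R)] (hI : I.facts.Finite)
    (h : step S I = some J) : ∃ θ, Next S I θ J := by
  have hkd (hno : ¬ ∃ τ : KDTrigger R Dom, τ.IsFirst S I) (τ : KDTrigger R Dom) :
      ¬ τ.Applicable S I := fun hτ => hno (KDTrigger.exists_isFirst hI hτ)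
  have hid (hno : ¬ ∃ τ : IDTrigger R Dom, τ.IsFirst S I) (τ : IDTrigger R Dom) :
      ¬ τ.Applicable S I := fun hτ => hno (IDTrigger.exists_isFirst hI hτ)
  unfold step at h
  split_ifs at h with h₁ h₂
  · obtain ⟨θ, hθ, rfl⟩ := KDTrigger.apply_eq_some h
    have happ := h₁.choose_spec.1
    exact ⟨θ, .kd _ θ happ (KDTrigger.isUnifier happ hθ)⟩
  · cases h
    exact ⟨id, .id _ (hkd h₁) h₂.choose_spec.1 fun hfull τ' hτ' =>
      h₂.choose_spec.level_le hτ' hfull⟩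
  · cases h
    exact ⟨id, .idle (hkd h₁) (hid h₂)⟩

namespace Next

theorem map_mem (h : Next S I θ J) {f : DBFact R Dom} (hf : f ∈ I.facts) : f.map θ ∈ J.facts := by
  cases h with
  | kd => exact ⟨f, hf, rfl⟩
  | id => exact Set.mem_insert_of_mem _ hf
  | idle => exact hf

theorem level_map_le (h : Next S I θ J) {f : DBFact R Dom} (hf : f ∈ I.facts) :
    J.level (f.map θ) ≤ I.level f := by
  cases h with
  | kd => exact Nat.sInf_le ⟨f, hf, rfl, rfl⟩
  | id τ _ happ => exact (IDTrigger.level_apply_of_mem happ hf).le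
  | idle => exact le_rfl

theorem exists_preimage_or_eq_newFact (h : Next S I θ J) {g : DBFact R Dom} (hg : g ∈ J.facts) :
    (∃ f ∈ I.facts, f.map θ = g ∧ I.level f = J.level g) ∨
      ∃ τ : IDTrigger R Dom, τ.Applicable S I ∧ θ = _root_.id ∧ J = τ.apply I ∧
        g = τ.newFact I := by
  cases h with
  | kd => exact .inl (ChaseState.exists_preimage_of_mem_map hg)
  | id τ _ happ =>
    obtain rfl | hg := hg
    · exact .inr ⟨τ, happ, rfl, rfl, rfl⟩
    · exact .inl ⟨g, hg, rfl, (IDTrigger.level_apply_of_mem happ hg).symm⟩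
  | idle => exact .inl ⟨g, hg, rfl, rfl⟩

theorem precedes (h : Next S I θ J) (x : Const Dom) : (θ x).Precedes x := by
  cases h with
  | kd _ _ _ hθ => exact hθ.precedes x
  | _ => exact .inl rfl

theorem map_eq_self (h : Next S I θ J) {f : DBFact R Dom} (hf : f ∈ J.facts) : f.map θ = f := by
  cases h with
  | kd _ _ _ hθ =>
    obtain ⟨g, -, rfl⟩ := hf
    exact Atom.map_eq_self fun _ => hθ.apply_apply _
  | _ => rfl

theorem next_le (h : Next S I θ J) : I.next ≤ J.next := by
  cases h with
  | id => exact Nat.le_add_right _ _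
  | _ => exact le_rfl

theorem finite_facts (h : Next S I θ J) (hI : I.facts.Finite) : J.facts.Finite := by
  cases h with
  | kd => exact hI.image _
  | id => exact hI.insert _
  | idle => exact hI

theorem rank_le_next (h : Next S I θ J) (hI : ∀ x ∈ Atom.consts I.facts, x.rank ≤ I.next) :
    ∀ x ∈ Atom.consts J.facts, x.rank ≤ J.next := by
  refine Atom.consts_subset_iff.2 fun g hg => ?_
  obtain ⟨f, hf, rfl, -⟩ | ⟨τ, happ, -, rfl, rfl⟩ := h.exists_preimage_or_eq_newFact hg
  · exact fun i => ((h.precedes _).rank_le.trans (hI _ (Atom.mem_consts_of_mem hf i))).trans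
      h.next_le
  · intro j
    by_cases hj : j ∈ Set.range τ.dep.Y
    · obtain ⟨i, rfl⟩ := hj
      rw [τ.newFact_args_Y]
      exact (hI _ (Atom.mem_consts_of_mem happ.2.1 (τ.dep.X i))).trans h.next_le
    · rw [τ.newFact_args_of_notMem I hj]
      exact Nat.add_lt_add_left j.2 _

end Next

/-! ### Runs -/

/-- An infinite sequence of chase steps from the database `D`. -/
structure Run (S : Deps R) (D : Finset (Atom R Dom)) where
  state : ℕ → ChaseState R Dom
  subst : ℕ → Const Dom → Const Dom
  state_zero : state 0 = init D
  next : ∀ n, Next S (state n) (subst n) (state (n + 1))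

namespace Run

variable {D : Finset (Atom R Dom)} (r : Run S D)

theorem finite_facts (n : ℕ) : (r.state n).facts.Finite := by
  induction n with
  | zero => exact r.state_zero ▸ D.finite_toSet.image _
  | succ n ih => exact (r.next n).finite_facts ih

theorem rank_le_next (n : ℕ) :
    ∀ x ∈ Atom.consts (r.state n).facts, x.rank ≤ (r.state n).next := by
  induction n with
  | zero =>
    rw [r.state_zero]
    refine Atom.consts_subset_iff.2 ?_
    rintro _ ⟨A, -, rfl⟩ _
    exact Nat.le_refl 0
  | succ n ih => exact (r.next n).rank_le_next ih

end Run

theorem Exists.exists_run [Finite R.Pred] [LinearOrder (DBFact R Dom)] [LinearOrder (InclDep R)]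
    [LinearOrder (KeyDep R)] {D : Finset (Atom R Dom)} (h : Exists S D) :
    ∃ r : Run S D, ∀ n, stage S D n = some (r.state n) := by
  choose I hI using fun n => Option.isSome_iff_exists.1 (h n)
  have hzero : I 0 = init D := (Option.some_injective _ (hI 0)).symm
  have hstep (n : ℕ) : step S (I n) = some (I (n + 1)) := by
    rw [← hI (n + 1), stage, hI n, Option.bind_some]
  have hfin (n : ℕ) : (I n).facts.Finite := by
    induction n with
    | zero => exact hzero ▸ D.finite_toSet.image _
    | succ n ih =>
      obtain ⟨θ, hθ⟩ := exists_next_of_step_eq_some ih (hstep n)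
      exact hθ.finite_facts ih
  choose θ hθ using fun n => exists_next_of_step_eq_some (hfin n) (hstep n)
  exact ⟨⟨I, θ, hzero, hθ⟩, hI⟩

end Chase

/-! ### Colorings of the constants -/

/-- Every inclusion dependency propagates at least one constant. -/
def Deps.WidthPos {R : RelSchema} (S : Deps R) : Prop := ∀ σ ∈ S.ids, 0 < σ.width

theorem exists_eqOn_of_eqOn_succ {α β : Type*} {s : ℕ → Set α} (hs : Monotone s) {c : ℕ → α → β}
    (hc : ∀ n, Set.EqOn (c (n + 1)) (c n) (s n)) : ∃ c' : α → β, ∀ n, Set.EqOn c' (c n) (s n) := by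
  have hle {m n : ℕ} (hmn : m ≤ n) : Set.EqOn (c n) (c m) (s m) := by
    induction n, hmn using Nat.le_induction with
    | base => exact Set.eqOn_refl _ _
    | succ n hmn ih => exact ((hc n).mono (hs hmn)).trans ih
  refine ⟨fun x => c (sInf {n | x ∈ s n}) x, fun n x hx => ?_⟩
  exact (hle (Nat.sInf_le hx) (Nat.sInf_mem (s := {n | x ∈ s n}) ⟨n, hx⟩)).symm

namespace Chase

open Atom

variable {R : RelSchema} {Dom κ : Type*} {S : Deps R} {I J : ChaseState R Dom}
  {θ : Const Dom → Const Dom} {col : Const Dom → κ}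

theorem KDTrigger.Applicable.color_eq {τ : KDTrigger R Dom} (hτ : τ.Applicable S I)
    (hcol : Monochromatic I.facts col) (i j : Fin (R.arity τ.kd.pred)) :
    col (τ.fst i) = col (τ.snd j) := by
  obtain ⟨-, hfst, hsnd, -, hkey⟩ := hτ
  obtain ⟨l, hl⟩ := τ.kd.key_nonempty
  calc col (τ.fst i) = col (τ.fst l) := hcol _ hfst i l
    _ = col (τ.snd l) := by rw [hkey l hl]
    _ = col (τ.snd j) := hcol _ hsnd l j

theorem Next.color_subst (h : Next S I θ J) (hcol : Monochromatic I.facts col) :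
    col ∘ θ = col := by
  cases h with
  | kd _ _ happ hθ =>
    refine funext fun x => hθ.apply_eq_of_unifies ?_ x
    rintro _ ⟨i, rfl⟩
    exact happ.color_eq hcol i i
  | _ => rfl

namespace IDTrigger

variable {τ : IDTrigger R Dom}

theorem exists_color (happ : τ.Applicable S I) (hw : 0 < τ.dep.width)
    (hrank : ∀ x ∈ consts I.facts, x.rank ≤ I.next) (hcol : Monochromatic I.facts col) :
    ∃ col' : Const Dom → κ, Monochromatic (τ.apply I).facts col' ∧
      Set.EqOn col' col {x | x.rank ≤ I.next} := by
  let k := col (τ.tup (τ.dep.X ⟨0, hw⟩))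
  let col' : Const Dom → κ := fun x => if x.rank ≤ I.next then col x else k
  have hold : Set.EqOn col' col {x | x.rank ≤ I.next} := fun x hx => if_pos hx
  have hfacts (f) (hf : f ∈ I.facts) (i) : col' (f.args i) = col (f.args i) :=
    hold (hrank _ (mem_consts_of_mem hf i))
  have hnew (j) : col' ((τ.newFact I).args j) = k := by
    by_cases hj : j ∈ Set.range τ.dep.Y
    · obtain ⟨i, rfl⟩ := hj
      rw [τ.newFact_args_Y]
      exact (hfacts _ happ.2.1 _).trans (hcol _ happ.2.1 _ _)
    · rw [τ.newFact_args_of_notMem I hj]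
      exact if_neg (by simp [Const.rank])
  refine ⟨col', ?_, hold⟩
  rintro f (rfl | hf) i j
  · rw [hnew, hnew]
  · rw [hfacts f hf, hfacts f hf, hcol f hf]

theorem color_newFact (happ : τ.Applicable S I) (hw : 0 < τ.dep.width)
    (hcol : Monochromatic (τ.apply I).facts col) (i : Fin (R.arity τ.dep.src))
    (j : Fin (R.arity τ.dep.tgt)) : col ((τ.newFact I).args j) = col (τ.tup i) := by
  calc col ((τ.newFact I).args j)
    _ = col ((τ.newFact I).args (τ.dep.Y ⟨0, hw⟩)) := hcol _ (Set.mem_insert _ _) j _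
    _ = col (τ.tup (τ.dep.X ⟨0, hw⟩)) := by rw [τ.newFact_args_Y]
    _ = col (τ.tup i) := hcol _ (Set.mem_insert_of_mem _ happ.2.1) _ i

theorem newFact_mem_coloredIn_iff (happ : τ.Applicable S I) (hw : 0 < τ.dep.width)
    (hcol : Monochromatic (τ.apply I).facts col) {K : Set κ} :
    τ.newFact I ∈ coloredIn (τ.apply I).facts col K ↔ τ.fact ∈ coloredIn I.facts col K := by
  constructor
  · exact fun h => ⟨happ.2.1, fun i => color_newFact happ hw hcol i (τ.dep.Y ⟨0, hw⟩) ▸ h.2 _⟩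
  · exact fun h => ⟨Set.mem_insert _ _, fun j =>
      (color_newFact happ hw hcol (τ.dep.X ⟨0, hw⟩) j).symm ▸ h.2 (τ.dep.X ⟨0, hw⟩)⟩

end IDTrigger

theorem Next.exists_color (h : Next S I θ J) (hS : S.WidthPos)
    (hrank : ∀ x ∈ consts I.facts, x.rank ≤ I.next) (hcol : Monochromatic I.facts col) :
    ∃ col' : Const Dom → κ, Monochromatic J.facts col' ∧
      Set.EqOn col' col {x | x.rank ≤ I.next} := by
  have hθ := h.color_subst hcol
  cases h with
  | kd => exact ⟨col, .image_map (hθ.symm ▸ hcol), Set.eqOn_refl _ _⟩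
  | id τ _ happ => exact IDTrigger.exists_color happ (hS _ happ.1) hrank hcol
  | idle => exact ⟨col, hcol, Set.eqOn_refl _ _⟩

namespace Run

variable {D : Finset (Atom R Dom)}

/-- A coloring of the constants for which all facts of all stages are monochromatic. -/
def IsColoring (r : Run S D) (col : Const Dom → κ) : Prop :=
  ∀ n, Monochromatic (r.state n).facts col

theorem next_mono (r : Run S D) : Monotone fun n => (r.state n).next :=
  monotone_nat_of_le_succ fun n => (r.next n).next_le

theorem exists_coloring (r : Run S D) (hS : S.WidthPos) {col : Const Dom → κ}
    (hD : Monochromatic (init D).facts col) :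
    ∃ col' : Const Dom → κ, r.IsColoring col' ∧ ∀ c, col' (.dom c) = col (.dom c) := by
  choose next hnext hold using fun n (c : {c : Const Dom → κ // Monochromatic (r.state n).facts c})
    => (r.next n).exists_color hS (r.rank_le_next n) c.2
  let c (n : ℕ) : {c : Const Dom → κ // Monochromatic (r.state n).facts c} :=
    Nat.rec ⟨col, r.state_zero ▸ hD⟩ (fun n c => ⟨next n c, hnext n c⟩) n
  obtain ⟨col', hcol'⟩ := exists_eqOn_of_eqOn_succ (s := fun n => {x | x.rank ≤ (r.state n).next})
    (c := fun n => (c n).1) (fun m n hmn x hx => le_trans hx (r.next_mono hmn))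
    fun n => hold n (c n)
  refine ⟨col', fun n f hf i j => ?_, fun d => hcol' 0 (Nat.zero_le _)⟩
  have hargs (i) : col' (f.args i) = (c n).1 (f.args i) :=
    hcol' n (r.rank_le_next n _ (mem_consts_of_mem hf i))
  rw [hargs, hargs, (c n).2 f hf i j]

end Run

end Chase

namespace Chase

/-! ### A numerical bound on the number of steps -/

/-- A bound on the number of steps that can be made with `c` constants and `a` absent facts,
if no new constants are introduced. -/
def quietBound (Q : ℕ → ℕ) (c a : ℕ) : ℕ := a + ∑ i ∈ Finset.range c, (Q i + 1)

/-- A bound on the number of steps that can be made with `c` constants and `a` absent facts,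
if at most `W` new constants are introduced at most `u` times. -/
def stepBound (Q : ℕ → ℕ) (W : ℕ) : ℕ → ℕ → ℕ → ℕ
  | 0, c, a => quietBound Q c a
  | u + 1, c, a => quietBound Q c a + 1 + stepBound Q W u (c + W) (Q (c + W))

theorem quietBound_mono (Q : ℕ → ℕ) {c c' a a' : ℕ} (hc : c ≤ c') (ha : a ≤ a') :
    quietBound Q c a ≤ quietBound Q c' a' :=
  add_le_add ha (Finset.sum_le_sum_of_subset (Finset.range_mono hc))

theorem quietBound_lt (Q : ℕ → ℕ) {c c' a a' : ℕ} (hc : c' < c) (ha : a' ≤ Q c') :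
    quietBound Q c' a' < quietBound Q c a := by
  refine lt_of_lt_of_le ?_ (quietBound_mono Q (Nat.succ_le_of_lt hc) (Nat.zero_le a))
  simp only [quietBound, Finset.sum_range_succ]
  omega

theorem stepBound_mono_right {Q : ℕ → ℕ} (hQ : Monotone Q) (W : ℕ)
    (u : ℕ) {c c' a a' : ℕ} (hc : c ≤ c') (ha : a ≤ a') :
    stepBound Q W u c a ≤ stepBound Q W u c' a' := by
  induction u generalizing c c' a a' with
  | zero => exact quietBound_mono Q hc ha
  | succ u ih =>
    have h₁ := quietBound_mono Q hc ha
    have h₂ := ih (Nat.add_le_add_right hc W) (hQ (Nat.add_le_add_right hc W))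
    simp only [stepBound]
    omega

theorem stepBound_mono_left {Q : ℕ → ℕ} (hQ : Monotone Q) (W : ℕ)
    {u u' : ℕ} (hu : u ≤ u') {c a : ℕ} (ha : a ≤ Q c) :
    stepBound Q W u c a ≤ stepBound Q W u' c a := by
  induction u', hu using Nat.le_induction with
  | base => exact le_rfl
  | succ n _ ih =>
    have := stepBound_mono_right hQ W n (Nat.le_add_right c W)
      (ha.trans (hQ (Nat.le_add_right c W)))
    simp only [stepBound]
    omega

theorem stepBound_lt_of_absent_lt {Q : ℕ → ℕ} (hQ : Monotone Q) (W : ℕ)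
    {u u' c a a' : ℕ} (hu : u' ≤ u) (ha' : a' < a) (ha : a ≤ Q c) :
    stepBound Q W u' c a' < stepBound Q W u c a := by
  refine (stepBound_mono_left hQ W hu (ha'.le.trans ha)).trans_lt ?_
  cases u <;> simp only [stepBound, quietBound] <;> omega

theorem stepBound_lt_of_consts_lt {Q : ℕ → ℕ} (hQ : Monotone Q) (W : ℕ)
    {u u' c c' a a' : ℕ} (hu : u' ≤ u) (hc : c' < c)
    (ha : a' ≤ Q c') : stepBound Q W u' c' a' < stepBound Q W u c a := by
  refine (stepBound_mono_left hQ W hu ha).trans_lt ?_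
  have h₁ := quietBound_lt Q (a := a) hc ha
  cases u with
  | zero => exact h₁
  | succ u =>
    have h₂ := stepBound_mono_right hQ W u (Nat.add_le_add_right hc.le W)
      (hQ (Nat.add_le_add_right hc.le W))
    simp only [stepBound]
    omega

theorem stepBound_lt_of_violations_lt {Q : ℕ → ℕ} (hQ : Monotone Q) (W : ℕ)
    {u u' c c' a a' : ℕ} (hu : u' < u) (hc : c' ≤ c + W)
    (ha : a' ≤ Q c') : stepBound Q W u' c' a' < stepBound Q W u c a := by
  obtain ⟨u, rfl⟩ : ∃ w, u = w + 1 := ⟨u - 1, by omega⟩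
  have h₁ := stepBound_mono_left hQ W (Nat.lt_succ_iff.1 hu) ha
  have h₂ := stepBound_mono_right hQ W u hc (ha.trans (hQ hc))
  simp only [stepBound]
  omega

end Chase

namespace Chase

/-! ### Violations of inclusion dependencies -/

open Atom

variable {R : RelSchema} {Dom κ : Type*} {S : Deps R} {I J : ChaseState R Dom}
  {θ : Const Dom → Const Dom} {col : Const Dom → κ} {K : Set κ} {v : ℕ}

/-- The violations of inclusion dependencies, of level at most `v`, by facts of colors in `K`. -/
def violations (S : Deps R) (I : ChaseState R Dom) (col : Const Dom → κ) (K : Set κ) (v : ℕ) :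
    Set (IDTrigger R Dom) :=
  {τ | τ.Applicable S I ∧ τ.fact ∈ coloredIn I.facts col K ∧ I.level τ.fact ≤ v}

theorem finite_violations [Finite R.Pred] (hI : I.facts.Finite) :
    (violations S I col K v).Finite :=
  (IDTrigger.finite_applicable hI).subset fun _ hτ => hτ.1

theorem ncard_violations_le [Finite R.Pred] (hI : I.facts.Finite) :
    (violations S I col K v).ncard ≤
      Nat.card (InclDep R) * count R (consts (coloredIn I.facts col K)).ncard := by
  have hfin := finite_coloredIn hI col K
  calc (violations S I col K v).ncard
    _ ≤ (Set.univ ×ˢ coloredIn I.facts col K : Set (InclDep R × DBFact R Dom)).ncard :=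
      Set.ncard_le_ncard_of_injOn _ (fun _ hτ => ⟨trivial, hτ.2.1⟩)
        IDTrigger.dep_fact_injective.injOn (Set.finite_univ.prod hfin)
    _ = Nat.card (InclDep R) * (coloredIn I.facts col K).ncard := by
      rw [Set.ncard_prod, Set.ncard_univ]
    _ ≤ _ := Nat.mul_le_mul_left _ (ncard_le_count_consts hfin)

/-- Replace the constants of the tuple of a trigger. -/
def IDTrigger.map (θ : Const Dom → Const Dom) (τ : IDTrigger R Dom) : IDTrigger R Dom :=
  ⟨τ.dep, θ ∘ τ.tup⟩

theorem IDTrigger.exists_of_map_eq_fact {τ : IDTrigger R Dom} {f : DBFact R Dom}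
    (h : f.map θ = τ.fact) : ∃ τ' : IDTrigger R Dom, τ'.fact = f ∧ τ'.map θ = τ := by
  obtain ⟨s, rfl, hs⟩ := Atom.exists_of_map_eq_mk h
  exact ⟨⟨τ.dep, s⟩, rfl, congrArg (IDTrigger.mk τ.dep) (funext hs)⟩

namespace Next

theorem map_mem_coloredIn_iff (h : Next S I θ J) (hI : Monochromatic I.facts col)
    {f : DBFact R Dom} (hf : f ∈ I.facts) :
    f.map θ ∈ coloredIn J.facts col K ↔ f ∈ coloredIn I.facts col K := by
  have hθ (x) : col (θ x) = col x := congrFun (h.color_subst hI) x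
  simp only [coloredIn, Set.mem_ofPred_eq, Atom.map, hθ, hf, true_and, and_iff_right_iff_imp]
  exact fun _ => h.map_mem hf

theorem exists_preimage_or_eq_newFact_of_mem_coloredIn (h : Next S I θ J) (hS : S.WidthPos)
    (hI : Monochromatic I.facts col) (hJ : Monochromatic J.facts col) {g : DBFact R Dom}
    (hg : g ∈ coloredIn J.facts col K) :
    (∃ f ∈ coloredIn I.facts col K, f.map θ = g ∧ I.level f = J.level g) ∨
      ∃ τ : IDTrigger R Dom, τ.Applicable S I ∧ θ = _root_.id ∧ J = τ.apply I ∧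
        g = τ.newFact I ∧ τ.fact ∈ coloredIn I.facts col K := by
  obtain ⟨f, hf, rfl, hl⟩ | ⟨τ, happ, hθ, rfl, rfl⟩ := h.exists_preimage_or_eq_newFact hg.1
  · exact .inl ⟨f, (h.map_mem_coloredIn_iff hI hf).1 hg, rfl, hl⟩
  · exact .inr ⟨τ, happ, hθ, rfl, rfl,
      (IDTrigger.newFact_mem_coloredIn_iff happ (hS _ happ.1) hJ).1 hg⟩

theorem applicable_of_map (h : Next S I θ J) {τ : IDTrigger R Dom}
    (hτ : (τ.map θ).Applicable S J) (hfact : τ.fact ∈ I.facts) : τ.Applicable S I := by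
  refine ⟨hτ.1, hfact, ?_⟩
  rintro ⟨t, ht, hYX⟩
  exact hτ.2.2 ⟨θ ∘ t, h.map_mem ht, fun i => congrArg θ (hYX i)⟩

theorem mem_image_violations_or_exists_level_lt (h : Next S I θ J) (hS : S.WidthPos)
    (hI : Monochromatic I.facts col) (hJ : Monochromatic J.facts col) {τ : IDTrigger R Dom}
    (hτ : τ ∈ violations S J col K v) :
    τ ∈ IDTrigger.map θ '' violations S I col K v ∨
      ∃ τ' ∈ violations S I col K v, I.level τ'.fact < v := by
  obtain ⟨happ, hK, hv⟩ := hτ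
  obtain ⟨f, hf, hmap, hl⟩ | ⟨τ', happ', -, rfl, hnew, hK'⟩ :=
    h.exists_preimage_or_eq_newFact_of_mem_coloredIn hS hI hJ hK
  · obtain ⟨τ', rfl, rfl⟩ := IDTrigger.exists_of_map_eq_fact hmap
    exact .inl ⟨τ', ⟨h.applicable_of_map happ hf.1, hf, hl.trans_le hv⟩, rfl⟩
  · rw [hnew, IDTrigger.level_apply_newFact] at hv
    exact .inr ⟨τ', ⟨happ', hK', Nat.le_of_succ_le hv⟩, hv⟩

theorem violations_nonempty (h : Next S I θ J) (hS : S.WidthPos)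
    (hI : Monochromatic I.facts col) (hJ : Monochromatic J.facts col)
    (hne : (violations S J col K v).Nonempty) : (violations S I col K v).Nonempty := by
  obtain ⟨τ, hτ⟩ := hne
  obtain ⟨τ', hτ', -⟩ | ⟨τ', hτ', -⟩ := h.mem_image_violations_or_exists_level_lt hS hI hJ hτ
  exacts [⟨τ', hτ'⟩, ⟨τ', hτ'⟩]

theorem violations_subset_image (h : Next S I θ J) (hS : S.WidthPos)
    (hI : Monochromatic I.facts col) (hJ : Monochromatic J.facts col)
    (hv : ∀ τ ∈ violations S I col K v, v ≤ I.level τ.fact) :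
    violations S J col K v ⊆ IDTrigger.map θ '' violations S I col K v := fun _ hτ =>
  (h.mem_image_violations_or_exists_level_lt hS hI hJ hτ).resolve_right
    fun ⟨τ', hτ', hlt⟩ => hlt.not_ge (hv τ' hτ')

theorem ncard_violations_le [Finite R.Pred] (h : Next S I θ J) (hS : S.WidthPos)
    (hfin : I.facts.Finite) (hI : Monochromatic I.facts col) (hJ : Monochromatic J.facts col)
    (hv : ∀ τ ∈ violations S I col K v, v ≤ I.level τ.fact) :
    (violations S J col K v).ncard ≤ (violations S I col K v).ncard :=
  have hviol := finite_violations hfin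
  (Set.ncard_le_ncard (h.violations_subset_image hS hI hJ hv) (hviol.image _)).trans
    (Set.ncard_image_le hviol)

end Next

/-! ### Facts and constants of a set of colors after a step -/

theorem Next.level_le_succ (h : Next S I θ J) (hS : S.WidthPos)
    (hI : Monochromatic I.facts col) (hJ : Monochromatic J.facts col) {M : ℕ}
    (hM : ∀ f ∈ coloredIn I.facts col K, I.level f ≤ M) :
    ∀ g ∈ coloredIn J.facts col K, J.level g ≤ M + 1 := by
  intro g hg
  obtain ⟨f, hf, -, hl⟩ | ⟨τ, -, -, rfl, rfl, hτ⟩ :=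
    h.exists_preimage_or_eq_newFact_of_mem_coloredIn hS hI hJ hg
  · exact hl ▸ (hM f hf).trans (Nat.le_succ M)
  · rw [IDTrigger.level_apply_newFact]
    exact Nat.succ_le_succ (hM _ hτ)

theorem consts_coloredIn_map (hθ : col ∘ θ = col) :
    consts (coloredIn (I.map θ).facts col K) = θ '' consts (coloredIn I.facts col K) := by
  rw [ChaseState.map, coloredIn_image_map, hθ, consts_image_map]

namespace IDTrigger

variable {τ : IDTrigger R Dom}

theorem consts_coloredIn_apply_subset (happ : τ.Applicable S I) (hw : 0 < τ.dep.width)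
    (hJ : Monochromatic (τ.apply I).facts col) :
    consts (coloredIn (τ.apply I).facts col K) ⊆
      consts (coloredIn I.facts col K) ∪
        (fun j => .fresh (I.next + j.val)) '' (Set.range τ.dep.Y)ᶜ := by
  refine consts_subset_iff.2 ?_
  rintro f ⟨rfl | hf, hK⟩ j
  · by_cases hj : j ∈ Set.range τ.dep.Y
    · obtain ⟨i, rfl⟩ := hj
      rw [τ.newFact_args_Y]
      have hfact := (newFact_mem_coloredIn_iff (K := K) happ hw hJ).1
        ⟨Set.mem_insert _ _, hK⟩
      exact .inl (mem_consts_of_mem hfact (τ.dep.X i))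
    · exact .inr ⟨j, hj, (τ.newFact_args_of_notMem I hj).symm⟩
  · have hfK : f ∈ coloredIn I.facts col K := ⟨hf, hK⟩
    exact .inl (mem_consts_of_mem hfK j)

theorem ncard_consts_coloredIn_apply_le [Finite R.Pred] (happ : τ.Applicable S I)
    (hw : 0 < τ.dep.width) (hfin : I.facts.Finite) (hJ : Monochromatic (τ.apply I).facts col) :
    (consts (coloredIn (τ.apply I).facts col K)).ncard ≤
      (consts (coloredIn I.facts col K)).ncard + R.maxArity := by
  have hnew : ((fun j => Const.fresh (Dom := Dom) (I.next + j.val)) ''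
      (Set.range τ.dep.Y)ᶜ).ncard ≤ R.maxArity := by
    refine (Set.ncard_image_le (Set.toFinite _)).trans ((Set.ncard_le_card _).trans ?_)
    simpa using R.arity_le_maxArity τ.dep.tgt
  refine (Set.ncard_le_ncard (consts_coloredIn_apply_subset happ hw hJ)
    ((finite_consts (finite_coloredIn hfin col K)).union (Set.toFinite _))).trans ?_
  exact (Set.ncard_union_le _ _).trans (Nat.add_le_add_left hnew _)

end IDTrigger

theorem Next.ncard_consts_coloredIn_le [Finite R.Pred] (h : Next S I θ J) (hS : S.WidthPos)
    (hfin : I.facts.Finite) (hI : Monochromatic I.facts col) (hJ : Monochromatic J.facts col) :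
    (consts (coloredIn J.facts col K)).ncard ≤
      (consts (coloredIn I.facts col K)).ncard + R.maxArity := by
  have hθ := h.color_subst hI
  cases h with
  | kd =>
    rw [consts_coloredIn_map hθ]
    exact (Set.ncard_image_le (finite_consts (finite_coloredIn hfin col K))).trans
      (Nat.le_add_right _ _)
  | id τ _ happ => exact τ.ncard_consts_coloredIn_apply_le happ (hS _ happ.1) hfin hJ
  | idle => exact Nat.le_add_right _ _

/-! ### A potential for the facts of a set of colors -/

/-- A bound on the number of steps that concern the facts of colors in `K` before all their
violations of level `v` are repaired, valid while there are none of smaller level. -/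
noncomputable def potential (S : Deps R) (I : ChaseState R Dom) (col : Const Dom → κ) (K : Set κ)
    (v : ℕ) : ℕ :=
  stepBound (count R) R.maxArity (violations S I col K v).ncard
    (consts (coloredIn I.facts col K)).ncard (absent (coloredIn I.facts col K)).ncard

/-- `J` has the same facts of colors in `K` as `I`, on the same levels. -/
def AgreeOn (I J : ChaseState R Dom) (col : Const Dom → κ) (K : Set κ) : Prop :=
  coloredIn J.facts col K = coloredIn I.facts col K ∧
    Set.EqOn J.level I.level (coloredIn I.facts col K)

theorem AgreeOn.potential_le [Finite R.Pred] (h : AgreeOn I J col K) (hfin : I.facts.Finite)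
    (hu : (violations S J col K v).ncard ≤ (violations S I col K v).ncard) :
    potential S J col K v ≤ potential S I col K v := by
  rw [potential, h.1]
  exact stepBound_mono_left count_mono _ hu (ncard_absent_le (finite_coloredIn hfin col K))

namespace KDTrigger

variable {τ : KDTrigger R Dom}

theorem ncard_consts_coloredIn_map_lt (happ : τ.Applicable S I) (hθ : IsUnifier τ.pairs θ)
    (hfin : I.facts.Finite) (hI : Monochromatic I.facts col) (hθcol : col ∘ θ = col)
    (hK : τ.fstFact ∈ coloredIn I.facts col K) :
    (consts (coloredIn (I.map θ).facts col K)).ncard <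
      (consts (coloredIn I.facts col K)).ncard := by
  have hc : (consts (coloredIn I.facts col K)).Finite :=
    finite_consts (finite_coloredIn hfin col K)
  have hK' : τ.sndFact ∈ coloredIn I.facts col K :=
    ⟨happ.2.2.1, fun i => happ.color_eq hI i i ▸ hK.2 i⟩
  rw [consts_coloredIn_map hθcol]
  refine (Set.ncard_image_le hc).lt_of_ne fun hcard => ?_
  have hinj := (Set.ncard_image_iff hc).1 hcard
  exact happ.2.2.2.1 (funext fun i =>
    hinj (mem_consts_of_mem hK i) (mem_consts_of_mem hK' i) (hθ.unifies _ ⟨i, rfl⟩))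

theorem agreeOn_map (happ : τ.Applicable S I) (hθ : IsUnifier τ.pairs θ)
    (hI : Monochromatic I.facts col) (hθcol : col ∘ θ = col)
    {i : Fin (R.arity τ.kd.pred)} (hi : col (τ.fst i) ∉ K) : AgreeOn I (I.map θ) col K := by
  have hpairs : ∀ p ∈ τ.pairs, col p.1 ∉ K ∧ col p.2 ∉ K := by
    rintro _ ⟨j, rfl⟩
    exact ⟨hI _ happ.2.1 i j ▸ hi, happ.color_eq hI i j ▸ hi⟩
  have hfix : ∀ x, col x ∈ K → θ x = x := fun x hx => hθ.apply_eq_self fun p hp =>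
    ⟨fun h => (hpairs p hp).1 (h ▸ hx), fun h => (hpairs p hp).2 (h ▸ hx)⟩
  have hmap : ∀ f ∈ coloredIn I.facts col K, f.map θ = f := fun f hf =>
    Atom.map_eq_self fun i => hfix _ (hf.2 i)
  constructor
  · rw [ChaseState.map, coloredIn_image_map, hθcol, Set.image_congr hmap, Set.image_id']
  · intro f hf
    obtain ⟨g, hg, hgf, hl⟩ := ChaseState.exists_preimage_of_mem_map
      (f := f) (I := I) (θ := θ) ⟨f, hf.1, hmap f hf⟩
    have hgK : g ∈ coloredIn I.facts col K :=
      ⟨hg, fun j => by subst hgf; exact congrFun hθcol _ ▸ hf.2 j⟩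
    rw [← hl, ← hgf, hmap g hgK]

end KDTrigger

namespace IDTrigger

variable {τ : IDTrigger R Dom}

theorem agreeOn_apply (happ : τ.Applicable S I) (hw : 0 < τ.dep.width)
    (hJ : Monochromatic (τ.apply I).facts col) (hK : τ.fact ∉ coloredIn I.facts col K) :
    AgreeOn I (τ.apply I) col K := by
  refine ⟨Set.ext fun f => ⟨?_, fun hf => ⟨Set.mem_insert_of_mem _ hf.1, hf.2⟩⟩,
    fun f hf => level_apply_of_mem happ hf.1⟩
  rintro ⟨rfl | hf, hfK⟩
  · exact (hK ((newFact_mem_coloredIn_iff happ hw hJ).1 ⟨Set.mem_insert _ _, hfK⟩)).elim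
  · exact ⟨hf, hfK⟩

theorem potential_lt_of_fullWidth [Finite R.Pred] (happ : τ.Applicable S I)
    (hw : 0 < τ.dep.width) (hfull : τ.dep.FullWidth) (hfin : I.facts.Finite)
    (hJ : Monochromatic (τ.apply I).facts col) (hK : τ.fact ∈ coloredIn I.facts col K)
    (hu : (violations S (τ.apply I) col K v).ncard ≤ (violations S I col K v).ncard) :
    potential S (τ.apply I) col K v < potential S I col K v := by
  have hpart := finite_coloredIn hfin col K
  have hnew : τ.newFact I ∈ coloredIn (τ.apply I).facts col K :=
    (newFact_mem_coloredIn_iff happ hw hJ).2 hK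
  have hssub : coloredIn I.facts col K ⊂ coloredIn (τ.apply I).facts col K :=
    ⟨fun f hf => ⟨Set.mem_insert_of_mem _ hf.1, hf.2⟩,
      fun hle => newFact_notMem happ (hle hnew).1⟩
  have hconsts : consts (coloredIn (τ.apply I).facts col K) ⊆ consts (coloredIn I.facts col K) := by
    have hle := consts_coloredIn_apply_subset (K := K) happ hw hJ
    rwa [hfull.2.range_eq, Set.compl_univ, Set.image_empty, Set.union_empty] at hle
  rw [potential, (consts_mono hssub.subset).antisymm hconsts |>.symm]
  exact stepBound_lt_of_absent_lt count_mono _ hu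
    (Set.ncard_lt_ncard (absent_ssubset_absent hssub hconsts) (finite_absent hpart))
    (ncard_absent_le hpart)

theorem potential_lt_of_mem_violations [Finite R.Pred] (hτ : τ ∈ violations S I col K v)
    (hw : 0 < τ.dep.width) (hfin : I.facts.Finite) (hJ : Monochromatic (τ.apply I).facts col)
    (hsub : violations S (τ.apply I) col K v ⊆ violations S I col K v) :
    potential S (τ.apply I) col K v < potential S I col K v := by
  have hrepaired : ¬ τ.Applicable S (τ.apply I) := fun h =>
    h.2.2 ⟨(τ.newFact I).args, Set.mem_insert _ _, τ.newFact_args_Y I⟩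
  exact stepBound_lt_of_violations_lt count_mono _
    (Set.ncard_lt_ncard ⟨hsub, fun hle => hrepaired (hle hτ).1⟩ (finite_violations hfin))
    (ncard_consts_coloredIn_apply_le hτ.1 hw hfin hJ)
    (ncard_absent_le (finite_coloredIn (hfin.insert _) col K))

end IDTrigger

theorem Next.potential_lt_or_agreeOn [Finite R.Pred] (h : Next S I θ J) (hS : S.WidthPos)
    (hfin : I.facts.Finite) (hI : Monochromatic I.facts col) (hJ : Monochromatic J.facts col)
    (hv : ∀ τ ∈ violations S I col K v, v ≤ I.level τ.fact)
    (hne : (violations S I col K v).Nonempty) :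
    potential S J col K v < potential S I col K v ∨ (∃ x, col x ∉ K) ∧ AgreeOn I J col K := by
  have hθcol := h.color_subst hI
  have hu := h.ncard_violations_le hS hfin hI hJ hv
  have hsub := h.violations_subset_image hS hI hJ hv
  have hJfin := h.finite_facts hfin
  cases h with
  | kd τ θ happ hθ =>
    by_cases hK : τ.fstFact ∈ coloredIn I.facts col K
    · exact .inl (stepBound_lt_of_consts_lt count_mono _ hu
        (τ.ncard_consts_coloredIn_map_lt happ hθ hfin hI hθcol hK)
        (ncard_absent_le (finite_coloredIn hJfin col K)))
    · obtain ⟨i, hi⟩ := not_forall.1 fun h => hK ⟨happ.2.1, h⟩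
      exact .inr ⟨⟨_, hi⟩, τ.agreeOn_map happ hθ hI hθcol hi⟩
  | id τ hkd happ hmin =>
    have hw := hS _ happ.1
    by_cases hK : τ.fact ∈ coloredIn I.facts col K
    · left
      by_cases hfull : τ.dep.FullWidth
      · exact τ.potential_lt_of_fullWidth happ hw hfull hfin hJ hK hu
      · obtain ⟨τ', hτ'⟩ := hne
        have hτ : τ ∈ violations S I col K v :=
          ⟨happ, hK, (hmin hfull τ' hτ'.1).trans hτ'.2.2⟩
        refine τ.potential_lt_of_mem_violations hτ hw hfin hJ fun σ hσ => ?_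
        obtain ⟨σ', hσ', rfl⟩ := hsub hσ
        exact hσ'
    · obtain ⟨i, hi⟩ := not_forall.1 fun h => hK ⟨happ.2.1, h⟩
      exact .inr ⟨⟨_, hi⟩, τ.agreeOn_apply happ hw hJ hK⟩
  | idle _ hid =>
    obtain ⟨τ, hτ⟩ := hne
    exact (hid τ hτ.1).elim

end Chase

namespace Chase

/-! ### Bounds on levels -/

open Atom

/-- A bound on the potential of facts with at most `c` constants. -/
noncomputable def potentialBound (R : RelSchema) (c : ℕ) : ℕ :=
  stepBound (count R) R.maxArity (Nat.card (InclDep R) * count R c) c (count R c)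

/-- A bound on the levels and the number of constants while the violations of one level are being
repaired, if they sum to at most `y` before the last violation of a smaller level is. -/
noncomputable def nextBound (R : RelSchema) (y : ℕ) : ℕ :=
  (y + R.maxArity + 1) + (R.maxArity + 1) * potentialBound R (y + R.maxArity + 1)

/-- A bound on the levels of the facts of a set of colors that starts with `g` facts, while it has
a violation of level at most `v`. -/
noncomputable def levelBound (R : RelSchema) (g v : ℕ) : ℕ :=
  (nextBound R)^[v + 1] (g * R.maxArity)

theorem id_le_nextBound (R : RelSchema) : id ≤ nextBound R := fun y => by
  simp only [nextBound, id]
  omega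

theorem levelBound_mono (R : RelSchema) (g : ℕ) : Monotone (levelBound R g) := fun _ _ h =>
  Function.monotone_iterate_of_id_le (id_le_nextBound R) (Nat.succ_le_succ h) _

theorem nextBound_levelBound (R : RelSchema) (g v : ℕ) :
    nextBound R (levelBound R g v) = levelBound R g (v + 1) :=
  (Function.iterate_succ_apply' _ _ _).symm

variable {R : RelSchema} {Dom κ : Type*} {S : Deps R} {I J : ChaseState R Dom}
  {θ : Const Dom → Const Dom} {col : Const Dom → κ} {K : Set κ} {u v b M y g : ℕ}

/-- A bound `b` that the levels and the number of constants of the facts of colors in `K` do not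
exceed as long as the potential decreases: each step adds at most one level and `R.maxArity`
constants. -/
def LevelBudget (S : Deps R) (I : ChaseState R Dom) (col : Const Dom → κ) (K : Set κ)
    (v b : ℕ) : Prop :=
  ∃ M, (∀ f ∈ coloredIn I.facts col K, I.level f ≤ M) ∧
    M + (consts (coloredIn I.facts col K)).ncard + (R.maxArity + 1) * potential S I col K v ≤ b

theorem potential_le_potentialBound [Finite R.Pred] (hfin : I.facts.Finite) {c : ℕ}
    (hc : (consts (coloredIn I.facts col K)).ncard ≤ c) :
    potential S I col K v ≤ potentialBound R c := by
  have ha := ncard_absent_le (finite_coloredIn hfin col K)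
  have hu := (ncard_violations_le (S := S) (v := v) hfin).trans
    (Nat.mul_le_mul_left _ (count_mono hc))
  exact (stepBound_mono_left count_mono _ hu ha).trans
    (stepBound_mono_right count_mono _ _ hc (ha.trans (count_mono hc)))

namespace LevelBudget

theorem mono (h : LevelBudget S I col K v b) {b' : ℕ} (hb : b ≤ b') :
    LevelBudget S I col K v b' := by
  obtain ⟨M, hM, hle⟩ := h
  exact ⟨M, hM, hle.trans hb⟩

theorem of_le [Finite R.Pred] (hfin : I.facts.Finite)
    (hM : ∀ f ∈ coloredIn I.facts col K, I.level f ≤ M)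
    (hy : M + (consts (coloredIn I.facts col K)).ncard ≤ y + R.maxArity + 1) :
    LevelBudget S I col K v (nextBound R y) :=
  ⟨M, hM, Nat.add_le_add hy (Nat.mul_le_mul_left _
    (potential_le_potentialBound hfin ((Nat.le_add_left _ M).trans hy)))⟩

theorem level_le (h : LevelBudget S I col K v b) {f : DBFact R Dom}
    (hf : f ∈ coloredIn I.facts col K) : I.level f ≤ b := by
  obtain ⟨M, hM, hle⟩ := h
  have := hM f hf
  omega

end LevelBudget

namespace Next

variable [Finite R.Pred] (h : Next S I θ J) (hS : S.WidthPos) (hfin : I.facts.Finite)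
  (hI : Monochromatic I.facts col) (hJ : Monochromatic J.facts col)

include h hS hfin hI hJ

theorem levelBudget (hv : ∀ τ ∈ violations S I col K v, v ≤ I.level τ.fact)
    (hne : (violations S I col K v).Nonempty) (hb : LevelBudget S I col K v b) :
    LevelBudget S J col K v b := by
  obtain ⟨M, hM, hle⟩ := hb
  obtain hlt | ⟨-, hagree⟩ := h.potential_lt_or_agreeOn hS hfin hI hJ hv hne
  · refine ⟨M + 1, h.level_le_succ hS hI hJ hM, ?_⟩
    have hc := h.ncard_consts_coloredIn_le (K := K) hS hfin hI hJ
    have hp := Nat.mul_le_mul_left (R.maxArity + 1) (Nat.succ_le_of_lt hlt)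
    rw [Nat.mul_succ] at hp
    omega
  · have hp := Nat.mul_le_mul_left (R.maxArity + 1)
      (hagree.potential_le hfin (h.ncard_violations_le hS hfin hI hJ hv))
    refine ⟨M, fun f hf => ?_, by rw [hagree.1]; omega⟩
    rw [hagree.1] at hf
    exact hagree.2 hf ▸ hM f hf

theorem levelBudget_nextBound (hb : LevelBudget S I col K u b) :
    LevelBudget S J col K v (nextBound R b) := by
  obtain ⟨M, hM, hle⟩ := hb
  refine .of_le (h.finite_facts hfin) (h.level_le_succ hS hI hJ hM) ?_
  have hc := h.ncard_consts_coloredIn_le (K := K) hS hfin hI hJ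
  omega

end Next

namespace Run

variable [Finite R.Pred] {D : Finset (Atom R Dom)} (r : Run S D) (hS : S.WidthPos)
  (hcol : r.IsColoring col) (hg : (coloredIn (init D).facts col K).ncard ≤ g)

include hg in
theorem levelBudget_zero : LevelBudget S (r.state 0) col K v (levelBound R g v) := by
  rw [levelBound, Function.iterate_succ_apply']
  refine .of_le (M := 0) (r.finite_facts 0) (by simp [r.state_zero, init]) ?_
  have hc := (ncard_consts_le (finite_coloredIn (r.finite_facts 0) col K)).trans
    (Nat.mul_le_mul_right R.maxArity (r.state_zero ▸ hg))
  have hiter : g * R.maxArity ≤ (nextBound R)^[v] (g * R.maxArity) :=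
    Function.id_le_iterate_of_id_le (id_le_nextBound R) v _
  omega

include hS hcol hg

theorem levelBudget (n : ℕ) (hne : (violations S (r.state n) col K v).Nonempty) :
    LevelBudget S (r.state n) col K v (levelBound R g v) := by
  induction n generalizing v with
  | zero => exact r.levelBudget_zero hg
  | succ n ih =>
    have hfin := r.finite_facts n
    by_cases hlow : ∃ τ ∈ violations S (r.state n) col K v, (r.state n).level τ.fact < v
    · obtain ⟨τ, ⟨happ, hK, -⟩, hlt⟩ := hlow
      have hb := (r.next n).levelBudget_nextBound (v := v) hS hfin (hcol n) (hcol (n + 1))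
        (ih ⟨τ, happ, hK, le_rfl⟩)
      rw [nextBound_levelBound] at hb
      exact hb.mono (levelBound_mono R g hlt)
    · have hne' := (r.next n).violations_nonempty hS (hcol n) (hcol (n + 1)) hne
      exact (r.next n).levelBudget hS hfin (hcol n) (hcol (n + 1))
        (fun τ hτ => not_lt.1 fun hlt => hlow ⟨τ, hτ, hlt⟩) hne' (ih hne')

theorem level_le_of_applicable {n : ℕ} {τ : IDTrigger R Dom} (happ : τ.Applicable S (r.state n))
    (hτ : τ.fact ∈ coloredIn (r.state n).facts col K) (hv : (r.state n).level τ.fact ≤ v)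
    {f : DBFact R Dom} (hf : f ∈ coloredIn (r.state (n + 1)).facts col K) :
    (r.state (n + 1)).level f ≤ levelBound R g v + 1 :=
  (r.next n).level_le_succ hS (hcol n) (hcol (n + 1))
    (fun _ hf => (r.levelBudget hS hcol hg n ⟨τ, happ, hτ, hv⟩).level_le hf) f hf

theorem exists_witness_level_le (n : ℕ) {τ : IDTrigger R Dom} (hdep : τ.dep ∈ S.ids)
    (hτ : τ.fact ∈ coloredIn (r.state n).facts col K) (hnot : ¬ τ.Applicable S (r.state n)) :
    ∃ t : Fin (R.arity τ.dep.tgt) → Const Dom,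
      (⟨τ.dep.tgt, t⟩ : DBFact R Dom) ∈ (r.state n).facts ∧
      (∀ i, t (τ.dep.Y i) = τ.tup (τ.dep.X i)) ∧
      (r.state n).level ⟨τ.dep.tgt, t⟩ ≤ levelBound R g ((r.state n).level τ.fact) + 1 := by
  obtain ⟨t, ht, hYX⟩ := not_not.1 fun h => hnot ⟨hdep, hτ.1, h⟩
  induction n generalizing τ with
  | zero => exact ⟨t, ht, hYX, by simp [r.state_zero, init]⟩
  | succ n ih =>
    have htK : (⟨τ.dep.tgt, t⟩ : DBFact R Dom) ∈ coloredIn (r.state (n + 1)).facts col K :=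
      ⟨ht, fun j => (hcol (n + 1) _ ht j (τ.dep.Y ⟨0, hS _ hdep⟩)).trans (congrArg col (hYX _)) ▸
        hτ.2 _⟩
    obtain ⟨f, hf, hmap, hl⟩ | ⟨τ', happ', -, hstate, hnew, hK'⟩ :=
      (r.next n).exists_preimage_or_eq_newFact_of_mem_coloredIn hS (hcol n) (hcol (n + 1)) hτ
    · obtain ⟨τ', rfl, rfl⟩ := IDTrigger.exists_of_map_eq_fact hmap
      by_cases happ' : τ'.Applicable S (r.state n)
      · exact ⟨t, ht, hYX, r.level_le_of_applicable hS hcol hg happ' hf hl.le htK⟩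
      · obtain ⟨s, hs, hYX'⟩ := not_not.1 fun h => happ' ⟨hdep, hf.1, h⟩
        obtain ⟨t', ht', hYX', hle⟩ := ih (τ := τ') hdep hf happ' s hs hYX'
        refine ⟨r.subst n ∘ t', (r.next n).map_mem ht',
          fun i => congrArg (r.subst n) (hYX' i), ?_⟩
        rw [← hl]
        exact ((r.next n).level_map_le ht').trans hle
    · refine ⟨t, ht, hYX, r.level_le_of_applicable hS hcol hg happ' hK' ?_ htK⟩
      rw [hstate, hnew, IDTrigger.level_apply_newFact]
      exact Nat.le_succ _

end Run

/-! ### Fairness -/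

namespace Run

variable {D : Finset (Atom R Dom)} (r : Run S D)

theorem isColoring_const (k : κ) : r.IsColoring fun _ => k := fun _ _ _ _ _ => rfl

theorem antitone_violations_nonempty (hS : S.WidthPos) (hcol : r.IsColoring col) :
    Antitone fun n => (violations S (r.state n) col K v).Nonempty :=
  antitone_nat_of_succ_le fun n => (r.next n).violations_nonempty hS (hcol n) (hcol (n + 1))

theorem exists_violations_eq_empty [Finite R.Pred] (hS : S.WidthPos) (hcol : r.IsColoring col)
    {N : ℕ} (hv : ∀ n, N ≤ n → ∀ τ ∈ violations S (r.state n) col Set.univ v,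
      v ≤ (r.state n).level τ.fact) :
    ∃ n, violations S (r.state n) col Set.univ v = ∅ := by
  by_contra! hne
  refine not_strictAnti_of_wellFoundedLT
    (fun m => potential S (r.state (N + m)) col Set.univ v) (strictAnti_nat_of_succ_lt fun m => ?_)
  exact ((r.next (N + m)).potential_lt_or_agreeOn hS (r.finite_facts _) (hcol _) (hcol _)
    (hv _ (Nat.le_add_right N m)) (hne _)).resolve_right fun ⟨⟨_, hx⟩, _⟩ => hx trivial

theorem eventually_lt_level_of_applicable [Finite R.Pred] (hS : S.WidthPos) (v : ℕ) :
    ∀ᶠ n in Filter.atTop, ∀ τ : IDTrigger R Dom, τ.Applicable S (r.state n) →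
      v < (r.state n).level τ.fact := by
  have hcol := r.isColoring_const ()
  suffices h : ∃ N, violations S (r.state N) (fun _ => ()) Set.univ v = ∅ by
    obtain ⟨N, hN⟩ := h
    refine Filter.eventually_atTop.2 ⟨N, fun n hn τ happ => lt_of_not_ge fun hle => ?_⟩
    exact (r.antitone_violations_nonempty hS hcol hn
      ⟨τ, happ, ⟨happ.2.1, fun _ => Set.mem_univ _⟩, hle⟩).ne_empty hN
  induction v with
  | zero => exact r.exists_violations_eq_empty hS hcol (N := 0) fun _ _ _ _ => Nat.zero_le _
  | succ v ih =>
    obtain ⟨N, hN⟩ := ih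
    refine r.exists_violations_eq_empty hS hcol (N := N) fun n hn τ hτ =>
      Nat.succ_le_of_lt (lt_of_not_ge fun hle => ?_)
    exact (r.antitone_violations_nonempty hS hcol hn ⟨τ, hτ.1, hτ.2.1, hle⟩).ne_empty hN

theorem frequently_forall_not_kdApplicable :
    ∃ᶠ n in Filter.atTop, ∀ τ : KDTrigger R Dom, ¬ τ.Applicable S (r.state n) := by
  refine Filter.frequently_atTop.2 fun N => ?_
  by_contra! hall
  have hcol := r.isColoring_const ()
  refine not_strictAnti_of_wellFoundedLT
    (fun m => (consts (coloredIn (r.state (N + m)).facts (fun _ => ()) Set.univ)).ncard)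
    (strictAnti_nat_of_succ_lt fun m => ?_)
  obtain ⟨τ, hτ⟩ := hall (N + m) (Nat.le_add_right N m)
  have hnext := r.next (N + m)
  change (consts (coloredIn (r.state (N + m + 1)).facts _ _)).ncard < _
  generalize r.state (N + m + 1) = J at hnext ⊢
  generalize r.subst (N + m) = θ at hnext
  cases hnext with
  | kd τ' _ happ hθ =>
    exact τ'.ncard_consts_coloredIn_map_lt happ hθ (r.finite_facts _) (hcol _) rfl
      ⟨happ.2.1, fun _ => Set.mem_univ _⟩
  | id _ hkd => exact (hkd τ hτ).elim
  | idle hkd => exact (hkd τ hτ).elim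

end Run

end Chase

/-! ### The limit of a run -/

/-- The facts in `T` satisfy the key dependencies. The arguments of the facts may be anything, since
this is also used for images of facts. -/
def Deps.KDsHoldIn {R : RelSchema} {α : Type*} (S : Deps R) (T : Set (Atom R α)) : Prop :=
  ∀ κ ∈ S.kds, ∀ s t : Fin (R.arity κ.pred) → α, (⟨κ.pred, s⟩ : Atom R α) ∈ T →
    (⟨κ.pred, t⟩ : Atom R α) ∈ T → (∀ i ∈ κ.key, s i = t i) → s = t

/-- The inclusion dependencies hold for the facts in `T`, with witnesses in `T'`. -/
def Deps.IDsHoldFrom {R : RelSchema} {α : Type*} (S : Deps R) (T T' : Set (Atom R α)) : Prop :=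
  ∀ σ ∈ S.ids, ∀ s : Fin (R.arity σ.src) → α, (⟨σ.src, s⟩ : Atom R α) ∈ T →
    ∃ t : Fin (R.arity σ.tgt) → α, (⟨σ.tgt, t⟩ : Atom R α) ∈ T' ∧ ∀ i, t (σ.Y i) = s (σ.X i)

namespace Chase

open Atom Filter

theorem exists_eventually_eq_of_rank_lt {α : Type*} (rank : α → ℕ) {u : ℕ → α}
    (h : ∀ᶠ n in atTop, u (n + 1) = u n ∨ rank (u (n + 1)) < rank (u n)) :
    ∃ a, ∀ᶠ n in atTop, u n = a := by
  obtain ⟨N, hN⟩ := eventually_atTop.1 h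
  obtain ⟨K, hK⟩ : ∃ K, ∀ k, rank (u (N + K)) ≤ rank (u (N + k)) :=
    ⟨_, fun k => Function.argmin_le (fun k => rank (u (N + k))) k⟩
  refine ⟨u (N + K), eventually_atTop.2 ⟨N + K, fun n hn => ?_⟩⟩
  induction n, hn using Nat.le_induction with
  | base => rfl
  | succ n hn ih =>
    have hNn := (Nat.le_add_right N K).trans hn
    refine ((hN n hNn).resolve_right fun hlt => ?_).trans ih
    obtain ⟨k, rfl⟩ := Nat.exists_eq_add_of_le hNn
    rw [ih] at hlt
    exact (hK (k + 1)).not_gt hlt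

namespace Run

variable {R : RelSchema} {Dom κ : Type*} {S : Deps R} {D : Finset (Atom R Dom)} (r : Run S D)

/-- The facts that are present with level at most `m` from some stage on. -/
def lowFacts (m : ℕ) : Set (DBFact R Dom) :=
  {f | ∀ᶠ n in atTop, f ∈ (r.state n).facts ∧ (r.state n).level f ≤ m}

theorem lowFacts_mono : Monotone r.lowFacts :=
  fun _ _ hm _ hf => hf.mono fun _ h => ⟨h.1, h.2.trans hm⟩

/-- The replacement of constants in the `k` steps after stage `n`. -/
def iter (n : ℕ) : ℕ → Const Dom → Const Dom
  | 0 => id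
  | k + 1 => r.subst (n + k) ∘ iter n k

theorem map_iter_mem (n k : ℕ) {f : DBFact R Dom} (hf : f ∈ (r.state n).facts) :
    f.map (r.iter n k) ∈ (r.state (n + k)).facts ∧
      (r.state (n + k)).level (f.map (r.iter n k)) ≤ (r.state n).level f := by
  induction k with
  | zero => exact ⟨hf, le_rfl⟩
  | succ k ih =>
    exact ⟨(r.next (n + k)).map_mem ih.1, ((r.next (n + k)).level_map_le ih.1).trans ih.2⟩

theorem iter_eq_self {n : ℕ} {x : Const Dom} (hx : ∀ m ≥ n, r.subst m x = x) (k : ℕ) :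
    r.iter n k x = x := by
  induction k with
  | zero => rfl
  | succ k ih => rw [iter, Function.comp_apply, ih, hx _ (Nat.le_add_right n k)]

theorem exists_limit (n : ℕ) : ∃ L : Const Dom → Const Dom,
    (∀ f ∈ (r.state n).facts, f.map L ∈ r.lowFacts ((r.state n).level f)) ∧
      ∀ x, (∀ m ≥ n, r.subst m x = x) → L x = x := by
  choose L hL using fun x => exists_eventually_eq_of_rank_lt Const.rank (u := fun k => r.iter n k x)
    (.of_forall fun k => (r.next (n + k)).precedes _)
  refine ⟨L, fun f hf => ?_, fun x hx => ?_⟩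
  · obtain ⟨K, hK⟩ := eventually_atTop.1 (eventually_all.2 fun i => hL (f.args i))
    refine eventually_atTop.2 ⟨n + K, fun m hm => ?_⟩
    obtain ⟨k, rfl⟩ := Nat.exists_eq_add_of_le ((Nat.le_add_right n K).trans hm)
    rw [← map_congr (hK k (Nat.le_of_add_le_add_left hm))]
    exact r.map_iter_mem n k hf
  · obtain ⟨k, hk⟩ := (hL x).exists
    exact hk.symm.trans (r.iter_eq_self hx k)

theorem map_dom_mem_lowFacts {A : Atom R Dom} (hA : A ∈ D) : A.map Const.dom ∈ r.lowFacts 0 := by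
  refine .of_forall fun n => ?_
  induction n with
  | zero => exact r.state_zero ▸ ⟨⟨A, hA, rfl⟩, le_rfl⟩
  | succ n ih =>
    have hmap : (A.map Const.dom).map (r.subst n) = A.map Const.dom :=
      map_eq_self fun i => ((r.next n).precedes _).eq_dom
    have hmem := (r.next n).map_mem ih.1
    have hlevel := (r.next n).level_map_le ih.1
    rw [hmap] at hmem hlevel
    exact ⟨hmem, hlevel.trans ih.2⟩

theorem kdsHoldIn_lowFacts (m : ℕ) : S.KDsHoldIn (r.lowFacts m) := by
  intro κ hκ s t hs ht hkey
  obtain ⟨n, hno, hs, ht⟩ :=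
    (r.frequently_forall_not_kdApplicable.and_eventually (hs.and ht)).exists
  by_contra hne
  exact hno ⟨κ, s, t⟩ ⟨hκ, hs.1, ht.1, hne, hkey⟩

theorem idsHoldFrom_lowFacts [Finite R.Pred] (hS : S.WidthPos) {col : Const Dom → κ}
    (hcol : r.IsColoring col) {g : ℕ} (hg : ∀ k, (coloredIn (init D).facts col {k}).ncard ≤ g)
    (m : ℕ) : S.IDsHoldFrom (r.lowFacts m) (r.lowFacts (levelBound R g m + 1)) := by
  intro σ hσ s hs
  obtain ⟨N, hN⟩ := eventually_atTop.1 (hs.and (r.eventually_lt_level_of_applicable hS m))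
  obtain ⟨⟨hmem, hle⟩, hlt⟩ := hN N le_rfl
  obtain ⟨t, ht, hYX, hlevel⟩ := r.exists_witness_level_le (τ := ⟨σ, s⟩) hS hcol
    (hg (col (s (σ.X ⟨0, hS σ hσ⟩)))) N hσ ⟨hmem, fun i => hcol N _ hmem _ _⟩
    fun happ => (hlt _ happ).not_ge hle
  obtain ⟨L, hL, hfix⟩ := r.exists_limit N
  refine ⟨L ∘ t, r.lowFacts_mono (hlevel.trans ?_) (hL _ ht), fun i => ?_⟩
  · exact Nat.succ_le_succ (levelBound_mono R g hle)
  · refine (congrArg L (hYX i)).trans (hfix _ fun n hn => ?_)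
    exact args_eq_of_map_eq_self ((r.next n).map_eq_self (hN (n + 1) (Nat.le_succ_of_le hn)).1.1) _

theorem mem_firstLevels [LinearOrder (DBFact R Dom)] [LinearOrder (InclDep R)]
    [LinearOrder (KeyDep R)] (hr : ∀ n, stage S D n = some (r.state n)) {m : ℕ}
    {f : DBFact R Dom} (hf : f ∈ r.lowFacts m) : f ∈ firstLevels S D m := by
  have hdecr : ∀ᶠ n in atTop, (r.state (n + 1)).level f = (r.state n).level f ∨
      (r.state (n + 1)).level f < (r.state n).level f := by
    filter_upwards [hf, (tendsto_add_atTop_nat 1).eventually hf] with n hn hn'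
    have hle := (r.next n).level_map_le hn.1
    rw [(r.next n).map_eq_self hn'.1] at hle
    exact hle.eq_or_lt
  obtain ⟨l, hl⟩ := exists_eventually_eq_of_rank_lt id (u := fun n => (r.state n).level f) hdecr
  obtain ⟨n, hn, hle⟩ := (hl.and hf).exists
  refine ⟨l, hn ▸ hle.2, ?_⟩
  filter_upwards [hl, hf] with n hn hmem
  exact ⟨_, hr n, hmem.1, hn⟩

end Run

end Chase

/-! ### Homomorphisms from the stages of a run -/

namespace Chase

open Atom

variable {R : RelSchema} {Dom κ γ : Type*} {S : Deps R} {I J : ChaseState R Dom}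
  {θ : Const Dom → Const Dom} {col : Const Dom → κ} {K : Set κ} {T T' : Set (Atom R γ)}
  {φ : Const Dom → γ}

theorem KDTrigger.map_mem_of_kdsHoldIn {τ : KDTrigger R Dom} (happ : τ.Applicable S I)
    (hθ : IsUnifier τ.pairs θ) (hcol : Monochromatic I.facts col) (hθcol : col ∘ θ = col)
    (hT : S.KDsHoldIn T) (hφ : ∀ f ∈ coloredIn I.facts col K, f.map φ ∈ T) :
    ∀ f ∈ coloredIn (I.map θ).facts col K, f.map φ ∈ T := by
  by_cases hK : ∀ i, col (τ.fst i) ∈ K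
  · have hK' : ∀ i, col (τ.snd i) ∈ K := fun i => happ.color_eq hcol i i ▸ hK i
    have heq : φ ∘ τ.fst = φ ∘ τ.snd := hT _ happ.1 _ _ (hφ _ ⟨happ.2.1, hK⟩)
      (hφ _ ⟨happ.2.2.1, hK'⟩) fun i hi => congrArg φ (happ.2.2.2.2 i hi)
    have hφθ : ∀ x, φ (θ x) = φ x := hθ.apply_eq_of_unifies fun _ ⟨i, hi⟩ => hi ▸ congrFun heq i
    rintro _ ⟨⟨f, hf, rfl⟩, hfK⟩
    rw [map_map, Atom.map_congr fun i => hφθ (f.args i)]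
    exact hφ f ⟨hf, fun i => congrFun hθcol (f.args i) ▸ hfK i⟩
  · obtain ⟨i, hi⟩ := not_forall.1 hK
    exact (agreeOn_map happ hθ hcol hθcol hi).1 ▸ hφ

theorem IDTrigger.exists_extension {τ : IDTrigger R Dom} (happ : τ.Applicable S I)
    (hw : 0 < τ.dep.width) (hrank : ∀ x ∈ consts I.facts, x.rank ≤ I.next)
    (hcol : Monochromatic (τ.apply I).facts col) (hT : S.IDsHoldFrom T T') (hTT' : T ⊆ T')
    (hφ : ∀ f ∈ coloredIn I.facts col K, f.map φ ∈ T) :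
    ∃ φ' : Const Dom → γ, Set.EqOn φ' φ {x | x.rank ≤ I.next} ∧
      ∀ f ∈ coloredIn (τ.apply I).facts col K, f.map φ' ∈ T' := by
  by_cases hK : τ.fact ∈ coloredIn I.facts col K
  · obtain ⟨t, ht, hYX⟩ := hT _ happ.1 _ (hφ _ hK)
    let new (j : Fin (R.arity τ.dep.tgt)) : Const Dom := .fresh (I.next + j)
    have hnew : Function.Injective new := fun i j h =>
      Fin.ext (Nat.add_left_cancel (Const.fresh.inj h))
    have hold : Set.EqOn (Function.extend new t φ) φ {x | x.rank ≤ I.next} := by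
      intro x hx
      refine Function.extend_apply' _ _ _ ?_
      rintro ⟨j, rfl⟩
      exact absurd hx (by simp [new, Const.rank])
    have hfacts (f) (hf : f ∈ I.facts) : f.map (Function.extend new t φ) = f.map φ :=
      map_congr fun i => hold (hrank _ (mem_consts_of_mem hf i))
    refine ⟨Function.extend new t φ, hold, ?_⟩
    rintro f ⟨rfl | hf, hfK⟩
    · suffices h : (τ.newFact I).map (Function.extend new t φ) = ⟨τ.dep.tgt, t⟩ from h ▸ ht
      refine congrArg (Atom.mk τ.dep.tgt) (funext fun j => ?_)
      by_cases hj : j ∈ Set.range τ.dep.Y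
      · obtain ⟨i, rfl⟩ := hj
        rw [τ.newFact_args_Y, hYX]
        exact hold (hrank _ (mem_consts_of_mem happ.2.1 _))
      · rw [τ.newFact_args_of_notMem I hj]
        exact hnew.extend_apply t φ j
    · exact hfacts f hf ▸ hTT' (hφ f ⟨hf, hfK⟩)
  · exact ⟨φ, Set.eqOn_refl _ _, fun f hf => hTT' (hφ f ((agreeOn_apply happ hw hcol hK).1 ▸ hf))⟩

theorem Next.exists_extension (h : Next S I θ J) (hS : S.WidthPos)
    (hrank : ∀ x ∈ consts I.facts, x.rank ≤ I.next) (hI : Monochromatic I.facts col)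
    (hJ : Monochromatic J.facts col) (hkd : S.KDsHoldIn T) (hid : S.IDsHoldFrom T T')
    (hTT' : T ⊆ T') (hφ : ∀ f ∈ coloredIn I.facts col K, f.map φ ∈ T) :
    ∃ φ' : Const Dom → γ, Set.EqOn φ' φ {x | x.rank ≤ I.next} ∧
      ∀ f ∈ coloredIn J.facts col K, f.map φ' ∈ T' := by
  have hθcol := h.color_subst hI
  cases h with
  | kd τ _ happ hθ =>
    exact ⟨φ, Set.eqOn_refl _ _, fun f hf =>
      hTT' (τ.map_mem_of_kdsHoldIn happ hθ hI hθcol hkd hφ f hf)⟩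
  | id τ _ happ => exact τ.exists_extension happ (hS _ happ.1) hrank hJ hid hTT' hφ
  | idle => exact ⟨φ, Set.eqOn_refl _ _, fun f hf => hTT' (hφ f hf)⟩

namespace Run

variable {D : Finset (Atom R Dom)} (r : Run S D)

theorem exists_hom (hS : S.WidthPos) (hcol : r.IsColoring col) {T : ℕ → Set (Atom R γ)}
    (hT : Monotone T) (hkd : ∀ n, S.KDsHoldIn (T n)) (hid : ∀ n, S.IDsHoldFrom (T n) (T (n + 1)))
    (hφ : ∀ f ∈ coloredIn (init D).facts col K, f.map φ ∈ T 0) (n : ℕ) :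
    ∃ φ' : Const Dom → γ, (∀ c, φ' (.dom c) = φ (.dom c)) ∧
      ∀ f ∈ coloredIn (r.state n).facts col K, f.map φ' ∈ T n := by
  induction n with
  | zero => exact ⟨φ, fun _ => rfl, r.state_zero ▸ hφ⟩
  | succ n ih =>
    obtain ⟨φ', hdom, hφ'⟩ := ih
    obtain ⟨φ'', hold, hφ''⟩ := (r.next n).exists_extension hS (r.rank_le_next n) (hcol n)
      (hcol (n + 1)) (hkd n) (hid n) (hT (Nat.le_succ n)) hφ'
    exact ⟨φ'', fun c => (hold (Nat.zero_le _)).trans (hdom c), hφ''⟩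

end Run

/-- A bound on the levels of the images of the facts of stage `n` of another run, if `g` bounds
the number of facts of each color at stage `0`. -/
noncomputable def transferBound (R : RelSchema) (g : ℕ) : ℕ → ℕ
  | 0 => 0
  | n + 1 => max (transferBound R g n) (levelBound R g (transferBound R g n) + 1)

theorem transferBound_mono (R : RelSchema) (g : ℕ) : Monotone (transferBound R g) :=
  monotone_nat_of_le_succ fun _ => le_max_left _ _

theorem Run.exists_hom_lowFacts [Finite R.Pred] (hS : S.WidthPos) {D₁ D₂ : Finset (Atom R Dom)}
    {κ₂ : Type*} (r₁ : Run S D₁) (hcol : r₁.IsColoring col) (r₂ : Run S D₂) {col₂ : Const Dom → κ₂}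
    (hcol₂ : r₂.IsColoring col₂) {g : ℕ}
    (hg : ∀ k, (coloredIn (init D₂).facts col₂ {k}).ncard ≤ g) {π : Dom → Dom}
    (hπ : ∀ A ∈ coloredIn (D₁ : Set (Atom R Dom)) (col ∘ Const.dom) K, A.map π ∈ D₂) (n : ℕ) :
    ∃ φ : Const Dom → Const Dom, (∀ c, φ (.dom c) = .dom (π c)) ∧
      ∀ f ∈ coloredIn (r₁.state n).facts col K, f.map φ ∈ r₂.lowFacts (transferBound R g n) := by
  refine r₁.exists_hom hS hcol (φ := fun | .dom c => .dom (π c) | .fresh k => .fresh k)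
    (r₂.lowFacts_mono.comp (transferBound_mono R g)) (fun n => r₂.kdsHoldIn_lowFacts _)
    (fun n => ?_) ?_ n
  · intro σ hσ s hs
    obtain ⟨t, ht, hYX⟩ := r₂.idsHoldFrom_lowFacts hS hcol₂ hg _ σ hσ s hs
    exact ⟨t, r₂.lowFacts_mono (le_max_right _ _) ht, hYX⟩
  · rintro _ ⟨⟨A, hA, rfl⟩, hK⟩
    exact r₂.map_dom_mem_lowFacts (hπ A ⟨hA, hK⟩)

end Chase

/-! ### The components of the join graph -/

theorem Atom.ncard_coloredIn_le_card_mul {R : RelSchema} {α κ : Type*}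
    (harity : ∀ p, 0 < R.arity p) {B : Set (Atom R α)} (hB : B.Finite) {col : α → κ}
    (hcol : Monochromatic B col) {g : ℕ} (hg : ∀ k, (coloredIn B col {k}).ncard ≤ g)
    (K : Finset κ) : (coloredIn B col K).ncard ≤ K.card * g := by
  have hsub : coloredIn B col K ⊆ ⋃ k ∈ K, coloredIn B col {k} := fun A hA =>
    Set.mem_biUnion (hA.2 ⟨0, harity _⟩) ⟨hA.1, fun i => hcol A hA.1 i _⟩
  calc (coloredIn B col K).ncard
    _ ≤ (⋃ k ∈ K, coloredIn B col {k}).ncard := Set.ncard_le_ncard hsub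
        (K.finite_toSet.biUnion fun k _ => finite_coloredIn hB col {k})
    _ ≤ ∑ k ∈ K, (coloredIn B col {k}).ncard := Finset.set_ncard_biUnion_le K _
    _ ≤ K.card * g := by simpa using Finset.sum_le_card_nsmul K _ g fun k _ => hg k

section JoinGraph

variable {R : RelSchema} {Dom : Type*} {D : Finset (Atom R Dom)}

/-- The components of the join graph in which the constant `x` occurs; there is exactly one if `x`
occurs in `D`. This is the color of `x`. -/
def joinComponents (D : Finset (Atom R Dom)) (x : Dom) : Set (joinGraph D).ConnectedComponent :=
  (joinGraph D).connectedComponentMk '' {A | x ∈ Set.range A.1.args}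

theorem joinComponents_args {A : Atom R Dom} (hA : A ∈ D) (i : Fin (R.arity A.pred)) :
    joinComponents D (A.args i) = {(joinGraph D).connectedComponentMk ⟨A, hA⟩} := by
  refine Set.eq_singleton_iff_unique_mem.2 ⟨⟨⟨A, hA⟩, ⟨i, rfl⟩, rfl⟩, ?_⟩
  rintro _ ⟨B, ⟨j, hj⟩, rfl⟩
  by_cases hBA : B = ⟨A, hA⟩
  · rw [hBA]
  · exact SimpleGraph.ConnectedComponent.sound (SimpleGraph.Adj.reachable ⟨hBA, j, i, hj⟩)

theorem monochromatic_joinComponents (D : Finset (Atom R Dom)) :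
    Atom.Monochromatic (D : Set (Atom R Dom)) (joinComponents D) := fun _ hA i j =>
  (joinComponents_args hA i).trans (joinComponents_args hA j).symm

theorem ncard_supp_le_largestComponent (C : (joinGraph D).ConnectedComponent) :
    C.supp.ncard ≤ largestComponent D := by
  have : Finite (joinGraph D).ConnectedComponent :=
    Finite.of_surjective (joinGraph D).connectedComponentMk Quot.mk_surjective
  exact le_ciSup (f := fun C : (joinGraph D).ConnectedComponent => C.supp.ncard)
    (Set.finite_range _).bddAbove C

theorem ncard_coloredIn_joinComponents_le (harity : ∀ p, 0 < R.arity p)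
    (k : Set (joinGraph D).ConnectedComponent) :
    (Atom.coloredIn (D : Set (Atom R Dom)) (joinComponents D) {k}).ncard ≤ largestComponent D := by
  obtain hempty | ⟨A, hA, hk⟩ :=
    (Atom.coloredIn (D : Set (Atom R Dom)) (joinComponents D) {k}).eq_empty_or_nonempty
  · simp [hempty]
  · let C := (joinGraph D).connectedComponentMk ⟨A, hA⟩
    obtain rfl : {C} = k := (joinComponents_args hA ⟨0, harity _⟩).symm.trans (hk _)
    have hsub : Atom.coloredIn (D : Set (Atom R Dom)) (joinComponents D) {{C}} ⊆
        Subtype.val '' C.supp := fun B hB =>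
      ⟨⟨B, hB.1⟩, Set.singleton_injective <|
        (joinComponents_args hB.1 ⟨0, harity _⟩).symm.trans (hB.2 _), rfl⟩
    calc (Atom.coloredIn (D : Set (Atom R Dom)) (joinComponents D) {{C}}).ncard
      _ ≤ (Subtype.val '' C.supp).ncard := Set.ncard_le_ncard hsub (Set.toFinite _)
      _ = C.supp.ncard := Set.ncard_image_of_injective _ Subtype.val_injective
      _ ≤ largestComponent D := ncard_supp_le_largestComponent C

theorem Chase.Run.exists_coloring_joinComponents {S : Deps R} (r : Chase.Run S D)
    (hS : S.WidthPos) : ∃ col : Const Dom → Set (joinGraph D).ConnectedComponent,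
      r.IsColoring col ∧ col ∘ Const.dom = joinComponents D := by
  let initCol : Const Dom → Set (joinGraph D).ConnectedComponent
    | .dom x => joinComponents D x
    | .fresh _ => ∅
  obtain ⟨col, hcol, hdom⟩ := r.exists_coloring hS (col := initCol)
    (Atom.Monochromatic.image_map (monochromatic_joinComponents D))
  exact ⟨col, hcol, funext hdom⟩

end JoinGraph

/-! ### Matches of a query up to renaming -/

namespace ConjQuery

variable {R : RelSchema} {Dom Var : Type*}

theorem IsWitness.mono {q : ConjQuery R Dom Var} {B B' : Set (DBFact R Dom)}
    {t : Fin q.arity → Const Dom} {μ : Var → Const Dom} (h : q.IsWitness B t μ) (hB : B ⊆ B') :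
    q.IsWitness B' t μ :=
  ⟨fun A hA => hB (h.1 A hA), h.2⟩

/-- The constants in the body of a query. -/
def consts (q : ConjQuery R Dom Var) : Set Dom :=
  Term.const ⁻¹' Atom.consts (q.body : Set (Atom R (Term Dom Var)))

theorem finite_consts (q : ConjQuery R Dom Var) : q.consts.Finite :=
  (Atom.finite_consts q.body.finite_toSet).preimage fun _ _ _ _ h => Term.const.inj h

theorem IsWitness.map {q : ConjQuery R Dom Var} {B B' : Set (DBFact R Dom)}
    {t : Fin q.arity → Const Dom} {μ : Var → Const Dom} (h : q.IsWitness B t μ)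
    {φ : Const Dom → Const Dom} (hφ : ∀ c ∈ q.consts, φ (.dom c) = .dom c)
    (hB : ∀ f ∈ B, f.map φ ∈ B') : q.IsWitness B' (φ ∘ t) (φ ∘ μ) := by
  refine ⟨fun A hA => ?_, fun i => congrArg φ (h.2 i)⟩
  have hmap : A.map (Term.value (φ ∘ μ)) = (A.map (Term.value μ)).map φ := by
    refine Atom.map_congr (g := φ ∘ Term.value μ) fun i => ?_
    cases hi : A.args i with
    | const c =>
      have hc : Term.const c ∈ Atom.consts (q.body : Set (Atom R (Term Dom Var))) :=
        hi ▸ Atom.mem_consts_of_mem hA i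
      exact (hφ c hc).symm
    | var x => rfl
  exact hmap ▸ hB _ (h.1 A hA)

/-- A database, an answer to `q` and the constants of `q`, with constants renamed to the elements
of a fixed finite set. There are only finitely many patterns. -/
abbrev Pattern (q : ConjQuery R Dom Var) (M : ℕ) : Type _ :=
  Set (Atom R (Fin (M + 1))) × (Fin q.arity → Fin (M + 1)) × (q.consts → Fin (M + 1))

/-- The pattern obtained from a database `B` and an answer `t` by the renaming `ε`. -/
def patternOf (q : ConjQuery R Dom Var) {M : ℕ} (ε : Dom → Fin (M + 1)) (B : Set (Atom R Dom))
    (t : Fin q.arity → Dom) : q.Pattern M :=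
  (Atom.map ε '' B, ε ∘ t, ε ∘ Subtype.val)

/-- The constants that occur in the database `B`, in the answer `t` or in the query. -/
def patternConsts (q : ConjQuery R Dom Var) (B : Set (Atom R Dom)) (t : Fin q.arity → Dom) :
    Set Dom :=
  Atom.consts B ∪ q.consts ∪ Set.range t

theorem exists_renaming_of_patternOf_eq (q : ConjQuery R Dom Var) {M : ℕ}
    {ε₁ ε₂ : Dom → Fin (M + 1)} {B₁ B₂ : Set (Atom R Dom)} {t₁ t₂ : Fin q.arity → Dom}
    (h : q.patternOf ε₁ B₁ t₁ = q.patternOf ε₂ B₂ t₂) (hε : Set.InjOn ε₂ (q.patternConsts B₂ t₂)) :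
    ∃ π : Dom → Dom, (∀ A ∈ B₁, A.map π ∈ B₂) ∧ π ∘ t₁ = t₂ ∧ ∀ c ∈ q.consts, π c = c := by
  have hinv (c : Dom) : ∃ c', ∀ d ∈ q.patternConsts B₂ t₂, ε₂ d = ε₁ c → c' = d := by
    by_cases hc : ∃ d ∈ q.patternConsts B₂ t₂, ε₂ d = ε₁ c
    · obtain ⟨d, hd, hdc⟩ := hc
      exact ⟨d, fun d' hd' h => hε hd hd' (hdc.trans h.symm)⟩
    · exact ⟨c, fun d hd hdc => (hc ⟨d, hd, hdc⟩).elim⟩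
  choose π hπ using hinv
  simp only [patternOf, Prod.mk.injEq] at h
  obtain ⟨hB, ht, hq⟩ := h
  refine ⟨π, fun A hA => ?_, funext fun i => ?_, fun c hc => ?_⟩
  · obtain ⟨A', hA', hAA'⟩ : A.map ε₁ ∈ Atom.map ε₂ '' B₂ := hB ▸ ⟨A, hA, rfl⟩
    obtain ⟨s, rfl, hs⟩ := Atom.exists_of_map_eq_mk hAA'
    rwa [show A.map π = ⟨A.pred, s⟩ from congrArg (Atom.mk A.pred) <| funext fun i =>
      hπ _ _ (.inl (.inl (Atom.mem_consts_of_mem hA' i))) (hs i)]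
  · exact hπ _ _ (.inr ⟨i, rfl⟩) (congrFun ht i).symm
  · exact hπ _ _ (.inl (.inr hc)) (congrFun hq ⟨c, hc⟩).symm

/-- A bound on the number of constants of the patterns that matches of `q` give rise to, if each
component of the join graph has at most `g` atoms. -/
noncomputable def patternSize (q : ConjQuery R Dom Var) (g : ℕ) : ℕ :=
  q.body.card * g * R.maxArity + q.consts.ncard + q.arity

theorem ncard_patternConsts_le [Finite R.Pred] (q : ConjQuery R Dom Var) {g : ℕ}
    {B : Set (Atom R Dom)} (hB : B.Finite) (hg : B.ncard ≤ q.body.card * g)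
    (t : Fin q.arity → Dom) : (q.patternConsts B t).ncard ≤ q.patternSize g := by
  have ht : (Set.range t).ncard ≤ q.arity := by
    simpa [Set.ncard_univ] using Set.ncard_image_le (f := t) Set.finite_univ
  calc (q.patternConsts B t).ncard
    _ ≤ (Atom.consts B).ncard + q.consts.ncard + (Set.range t).ncard :=
        (Set.ncard_union_le _ _).trans (Nat.add_le_add_right (Set.ncard_union_le _ _) _)
    _ ≤ q.patternSize g :=
        Nat.add_le_add (Nat.add_le_add_right ((Atom.ncard_consts_le hB).trans
          (Nat.mul_le_mul_right _ hg)) _) ht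

theorem exists_injOn_patternConsts [Finite R.Pred] (q : ConjQuery R Dom Var) {g : ℕ}
    {B : Set (Atom R Dom)} (hB : B.Finite) (hg : B.ncard ≤ q.body.card * g)
    (t : Fin q.arity → Dom) :
    ∃ ε : Dom → Fin (q.patternSize g + 1), Set.InjOn ε (q.patternConsts B t) := by
  have hfin : (q.patternConsts B t).Finite :=
    ((Atom.finite_consts hB).union q.finite_consts).union (Set.finite_range t)
  have hle : (q.patternConsts B t).encard ≤
      (Set.univ : Set (Fin (q.patternSize g + 1))).encard := by
    rw [← hfin.cast_ncard_eq, Set.encard_univ, ENat.card_eq_coe_fintype_card, Fintype.card_fin]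
    exact_mod_cast (q.ncard_patternConsts_le hB hg t).trans (Nat.le_succ _)
  obtain ⟨ε, -, hε⟩ := hfin.exists_injOn_of_encard_le hle
  exact ⟨ε, hε⟩

end ConjQuery

namespace Chase

open Atom

variable {R : RelSchema} {Dom Var : Type*} {S : Deps R} {q : ConjQuery R Dom Var}

/-- Some run has a match of `q` at stage `n` for which the atoms of the database that have the
colors of the match form the pattern `P`, together with the answer. -/
def Realized (S : Deps R) {M : ℕ} (P : q.Pattern M) (n : ℕ) : Prop :=
  ∃ (D : Finset (Atom R Dom)) (r : Run S D)
    (col : Const Dom → Set (joinGraph D).ConnectedComponent)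
    (K : Set (Set (joinGraph D).ConnectedComponent)) (μ : Var → Const Dom)
    (t : Fin q.arity → Dom) (ε : Dom → Fin (M + 1)),
    r.IsColoring col ∧ q.IsWitness (coloredIn (r.state n).facts col K) (Const.dom ∘ t) μ ∧
      q.patternOf ε (coloredIn D (col ∘ Const.dom) K) t = P

/-- A bound on the levels needed to match `q`, if each component of the join graph has at most `g`
atoms. The infimum is the first stage at which a pattern is realized, or the junk value `0` if the
pattern is never realized. -/
noncomputable def matchBound (S : Deps R) (q : ConjQuery R Dom Var) (g : ℕ) : ℕ :=
  ⨆ P : q.Pattern (q.patternSize g), transferBound R g (sInf {n | Realized S P n})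

theorem transferBound_le_matchBound [Finite R.Pred] {g : ℕ} (P : q.Pattern (q.patternSize g)) :
    transferBound R g (sInf {n | Realized S P n}) ≤ matchBound S q g := by
  have := q.finite_consts.to_subtype
  exact le_ciSup (f := fun P : q.Pattern (q.patternSize g) =>
    transferBound R g (sInf {n | Realized S P n})) (Set.finite_range _).bddAbove P

namespace Run

variable {κ : Type*} {D : Finset (Atom R Dom)} {col : Const Dom → κ} {g n : ℕ}
  {t : Fin q.arity → Dom} {μ : Var → Const Dom}

theorem exists_isWitness_of_realized [Finite R.Pred] (hS : S.WidthPos) (r : Run S D)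
    (hcol : r.IsColoring col) (hg : ∀ k, (coloredIn (init D).facts col {k}).ncard ≤ g) {M : ℕ}
    {ε : Dom → Fin (M + 1)} {B : Set (Atom R Dom)} (hB : B ⊆ D)
    (hε : Set.InjOn ε (q.patternConsts B t)) (h : Realized S (q.patternOf ε B t) n) :
    ∃ μ, q.IsWitness (r.lowFacts (transferBound R g n)) (Const.dom ∘ t) μ := by
  obtain ⟨D₁, r₁, col₁, K, μ₁, t₁, ε₁, hcol₁, hμ₁, hpattern⟩ := h
  obtain ⟨π, hπ, rfl, hπq⟩ := q.exists_renaming_of_patternOf_eq hpattern hε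
  obtain ⟨φ, hdom, hφ⟩ := exists_hom_lowFacts hS r₁ hcol₁ r hcol hg (fun A hA => hB (hπ A hA)) n
  have hanswer : Const.dom ∘ π ∘ t₁ = φ ∘ Const.dom ∘ t₁ := funext fun i => (hdom (t₁ i)).symm
  exact ⟨φ ∘ μ₁, hanswer ▸ hμ₁.map (fun c hc => (hdom c).trans (congrArg _ (hπq c hc))) hφ⟩

theorem exists_realized [Finite R.Pred] (harity : ∀ p, 0 < R.arity p) (r : Run S D)
    {col : Const Dom → Set (joinGraph D).ConnectedComponent} (hcol : r.IsColoring col)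
    (hdom : col ∘ Const.dom = joinComponents D)
    (hμ : q.IsWitness (r.state n).facts (Const.dom ∘ t) μ) :
    ∃ (B : Set (Atom R Dom)) (ε : Dom → Fin (q.patternSize (largestComponent D) + 1)),
      B ⊆ D ∧ Set.InjOn ε (q.patternConsts B t) ∧ Realized S (q.patternOf ε B t) n := by
  classical
  let K := q.body.image fun A => col (Term.value μ (A.args ⟨0, harity _⟩))
  have hcard : (coloredIn (D : Set (Atom R Dom)) (joinComponents D) K).ncard ≤
      q.body.card * largestComponent D :=
    (ncard_coloredIn_le_card_mul harity D.finite_toSet (monochromatic_joinComponents D)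
      (ncard_coloredIn_joinComponents_le harity) K).trans
      (Nat.mul_le_mul_right _ Finset.card_image_le)
  obtain ⟨ε, hε⟩ := q.exists_injOn_patternConsts (finite_coloredIn D.finite_toSet _ _) hcard t
  refine ⟨_, ε, fun A hA => hA.1, hε, D, r, col, K, μ, t, ε, hcol,
    ⟨fun A hA => ⟨hμ.1 A hA, fun i => ?_⟩, hμ.2⟩, by rw [hdom]⟩
  rw [hcol n _ (hμ.1 A hA) i ⟨0, harity _⟩]
  exact Finset.mem_coe.2 (Finset.mem_image_of_mem _ hA)

theorem exists_isWitness_lowFacts [Finite R.Pred] (harity : ∀ p, 0 < R.arity p)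
    (hS : S.WidthPos) (r : Run S D) (hμ : q.IsWitness (r.state n).facts (Const.dom ∘ t) μ) :
    ∃ μ, q.IsWitness (r.lowFacts (matchBound S q (largestComponent D))) (Const.dom ∘ t) μ := by
  obtain ⟨col, hcol, hdom⟩ := r.exists_coloring_joinComponents hS
  have hg (k) : (coloredIn (init D).facts col {k}).ncard ≤ largestComponent D := by
    rw [init, coloredIn_image_map, hdom]
    exact (Set.ncard_image_le (finite_coloredIn D.finite_toSet _ _)).trans
      (ncard_coloredIn_joinComponents_le harity k)
  obtain ⟨B, ε, hB, hε, hreal⟩ := r.exists_realized harity hcol hdom hμ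
  obtain ⟨μ', hμ'⟩ := r.exists_isWitness_of_realized hS hcol hg hB hε
    (Nat.sInf_mem (s := {n | Realized S (q.patternOf ε B t) n}) ⟨n, hreal⟩)
  exact ⟨μ', hμ'.mono (r.lowFacts_mono (transferBound_le_matchBound _))⟩

end Run

end Chase

theorem mainTheorem2_general {R : RelSchema} [Finite R.Pred] (harity : ∀ p, 0 < R.arity p)
    {S : Deps R} (hS : S.WidthPos) {Dom Var : Type*} (q : ConjQuery R Dom Var) :
    ∃ δM : ℕ → ℕ,
      ∀ [LinearOrder (DBFact R Dom)] [LinearOrder (InclDep R)] [LinearOrder (KeyDep R)]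
        (D : Finset (Atom R Dom)), Chase.Exists S D →
          ∀ t ∈ q.freshFreeAnswers (Chase.chase S D),
            ∃ μ : Var → Const Dom, q.IsWitness (Chase.chase S D) t μ ∧
              ∀ A ∈ q.body, A.map (Term.value μ) ∈
                Chase.firstLevels S D (δM (largestComponent D)) := by
  refine ⟨Chase.matchBound S q, ?_⟩
  rintro _ _ _ D hD t ⟨⟨μ, hμ, hhead⟩, hfree⟩
  choose t' ht' using hfree
  obtain rfl : t = Const.dom ∘ t' := funext ht'
  obtain ⟨r, hr⟩ := hD.exists_run
  obtain ⟨n, hn⟩ := ((Filter.eventually_all_finset q.body).2 hμ).exists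
  have hstage (A) (hA : A ∈ q.body) : A.map (Term.value μ) ∈ (r.state n).facts := by
    obtain ⟨I, hI, hmem⟩ := hn A hA
    exact Option.some_injective _ (hI.symm.trans (hr n)) ▸ hmem
  obtain ⟨μ', hμ'⟩ := r.exists_isWitness_lowFacts harity hS ⟨hstage, hhead⟩
  exact ⟨μ', hμ'.mono fun f hf => hf.mono fun n h => ⟨_, hr n, h.1⟩,
    fun A hA => r.mem_firstLevels hr (hμ'.1 A hA)⟩

/-! ### Conceptual dependencies -/

namespace EERSchema

theorem finite_pred (C : EERSchema) : Finite C.relSchema.Pred := by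
  have := C.finite_ent
  have := C.finite_rel
  have := C.finite_att
  refine Finite.of_surjective
    (Sum.elim PredSym.concept PredSym.att : (C.Ent ⊕ C.Rel) ⊕ C.Att → C.PredSym) ?_
  rintro (X | A)
  · exact ⟨.inl X, rfl⟩
  · exact ⟨.inr A, rfl⟩

theorem arity_pos (C : EERSchema) : ∀ p, 0 < C.relSchema.arity p
  | .concept X => C.conceptArity_pos X
  | .att _ => Nat.succ_pos _

theorem widthPos_cds (C : EERSchema) : C.cds.WidthPos := by
  rintro _ (_ | _ | _ | _ | ⟨R, _, _⟩ | _)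
  · exact C.conceptArity_pos _
  · exact Nat.one_pos
  · exact C.conceptArity_pos _
  · exact Nat.one_pos
  · exact Nat.two_pos.trans_le (C.two_le_relArity R)
  · exact Nat.one_pos

end EERSchema

theorem mainTheorem2 (C : EERSchema) {Dom Var : Type*} (q : ConjQuery C.relSchema Dom Var) :
    ∃ δM : ℕ → ℕ,
      ∀ [LinearOrder (DBFact C.relSchema Dom)] [LinearOrder (InclDep C.relSchema)]
        [LinearOrder (KeyDep C.relSchema)] (D : Finset (Atom C.relSchema Dom)),
        Chase.Exists C.cds D →
          ∀ t ∈ q.freshFreeAnswers (Chase.chase C.cds D),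
            ∃ μ : Var → Const Dom, q.IsWitness (Chase.chase C.cds D) t μ ∧
              ∀ A ∈ q.body, A.map (Term.value μ) ∈
                Chase.firstLevels C.cds D (δM (largestComponent D)) := by
  have := C.finite_pred
  exact mainTheorem2_general C.arity_pos C.widthPos_cds q
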